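/- All graphs are finite undirected multigraphs without loops; for a set $X$ write $X+a=X\cup\{a\}$ and $X-a=X\setminus\{a\}$. A graph is *bispanning* if its edge set is the union of two disjoint spanning trees; it is *atomic* if, in addition, its only bispanning subgraphs are itself and the one-vertex graphs. A graph is *simple* if it has no parallel edges. The vertex-connectivity is the greatest $k$ such that the graph is connected, has more than $k$ vertices, and remains connected after deleting any fewer than $k$ vertices. For a bispanning graph $G$ let $V_{\tau(G)}$ be the set of ordered pairs $(S,T)$ of disjoint spanning trees of $G$ with $S\cup T=E(G)$. For $(S,T)\in V_{\tau(G)}$ a pair $(e,f)\in S\times T$ is a *unique exchange* for $(S,T)$ if $f$ is the only edge of $T$ such that $(S-e+f,\;T+e-f)\in V_{\tau(G)}$; a pair $(e,f)\in T\times S$ is a unique exchange for $(S,T)$ if it is one for $(T,S)$. The directed multigraph $\vec\tau_3(G)$ has vertex set $V_{\tau(G)}$ and one arc $(e,f,S,T)$ for every $(S,T)\in V_{\tau(G)}$ and every unique exchange $(e,f)\in (S\times T)\cup(T\times S)$ for $(S,T)$; the arc leads from $(S,T)$ to $(S-e+f,\,T+e-f)$ if $e\in S$, and to $(S+e-f,\,T-e+f)$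 if $e\in T$. Let $G_1,G_2$ be graphs, $d_1$ an edge of $G_1$ and $d_2$ an edge of $G_2$. A *2-clique sum* $G_1\oplus_2G_2$ at $d_1,d_2$ is obtained from the disjoint union of $G_1$ and $G_2$ by identifying the ends of $d_1$ with the ends of $d_2$ (by one of the two bijections) and deleting $d_1$ and $d_2$. **Theorem.** Let $G$ be an atomic bispanning graph with vertex-connectivity $2$. Then $G$ is a 2-clique sum $G_1\oplus_2G_2$ of two simple bispanning graphs; and whenever $G\cong G_1\oplus_2G_2$ is a 2-clique sum of simple bispanning graphs $G_1,G_2$ at edges $d_1\in E(G_1)$, $d_2\in E(G_2)$, there is an isomorphism of directed multigraphs (bijections of vertices and of arcs that respect tails and heads) $$\vec\tau_3(G)\;\cong\;\eta_{d_1,d_2}\bigl(\vec\tau_3(G_1),\vec\tau_3(G_2)\bigr),$$ where the right-hand side is the following directed multigraph (the edge sets of $G_1$ and $G_2$ are taken disjoint). * Vertices: the pairs $((S_1,T_1),(S_2,T_2))\in V_{\tau(G_1)}\times V_{\tau(G_2)}$ such that neither ($d_1\in S_1$ and $d_2\in S_2$) nor ($d_1\in T_1$ and $d_2\in T_2$).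 * Arcs: the tuples $(e,f,(S_1,T_1),(S_2,T_2))$ where $((S_1,T_1),(S_2,T_2))$ is a vertex and one of the following holds: (a) $(e,f,S_1,T_1)$ is an arc of $\vec\tau_3(G_1)$ and $d_1\notin\{e,f\}$; (b) $(e,f,S_2,T_2)$ is an arc of $\vec\tau_3(G_2)$ and $d_2\notin\{e,f\}$; (c) $(e,d_1,S_1,T_1)$ is an arc of $\vec\tau_3(G_1)$ and $(d_2,f,S_2,T_2)$ is an arc of $\vec\tau_3(G_2)$; (d) $(e,d_2,S_2,T_2)$ is an arc of $\vec\tau_3(G_2)$ and $(d_1,f,S_1,T_1)$ is an arc of $\vec\tau_3(G_1)$. * Incidence: the tail of the arc is $((S_1,T_1),(S_2,T_2))$. Its head is obtained in case (a) by replacing $(S_1,T_1)$ by the head of $(e,f,S_1,T_1)$ in $\vec\tau_3(G_1)$; in case (b) by replacing $(S_2,T_2)$ by the head of $(e,f,S_2,T_2)$ in $\vec\tau_3(G_2)$; in cases (c) and (d) by replacing both $(S_1,T_1)$ and $(S_2,T_2)$ by the heads of the two named arcs of $\vec\tau_3(G_1)$ and $\vec\tau_3(G_2)$. -/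

import Mathlib

open scoped Graph

namespace Graph

section Basic

variable {α β : Type*}

/-- Any two vertices are joined by a path (and there is a vertex). Paths of a multigraph and of its
underlying simple graph join the same pairs of vertices. -/
def IsConnected (G : Graph α β) : Prop := G.toSimpleGraph.Connected

/-- A connected multigraph without cycles. A cycle of a multigraph is a loop, a pair of parallel
edges, or a cycle of length at least three of the underlying simple graph. -/
def IsTreeGraph (G : Graph α β) : Prop := G.Simple ∧ G.toSimpleGraph.IsTree

/-- The edge set `T` is a spanning tree: the graph `(V(G), T)` is a tree. -/
def IsSpanningTree (G : Graph α β) (T : Set β) : Prop :=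
  T ⊆ E(G) ∧ (G.restrict T).IsTreeGraph

/-- `S` and `T` are disjoint spanning trees whose union is the whole edge set. -/
def IsTreePair (G : Graph α β) (p : Set β × Set β) : Prop :=
  G.IsSpanningTree p.1 ∧ G.IsSpanningTree p.2 ∧ Disjoint p.1 p.2 ∧ p.1 ∪ p.2 = E(G)

theorem IsTreePair.swap {G : Graph α β} {p : Set β × Set β} (h : G.IsTreePair p) :
    G.IsTreePair p.swap :=
  ⟨h.2.1, h.1, h.2.2.1.symm, by rw [← h.2.2.2]; exact Set.union_comm _ _⟩

def IsBispanning (G : Graph α β) : Prop := ∃ p, G.IsTreePair p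

/-- A bispanning graph whose only bispanning subgraphs are itself and the one-vertex graphs. -/
def IsAtomicBispanning (G : Graph α β) : Prop :=
  G.IsBispanning ∧ ∀ H ≤ G, H.IsBispanning → H = G ∨ ∃ v, H = Graph.noEdge {v} β

def IsKVertexConnected (G : Graph α β) (k : ℕ) : Prop :=
  G.IsConnected ∧ (k : ℕ∞) < V(G).encard ∧
    ∀ X ⊆ V(G), X.encard < k → (G.deleteVerts X).IsConnected

/-- The vertex-connectivity of `G` is `k`. -/
def HasVertexConnectivity (G : Graph α β) (k : ℕ) : Prop :=
  IsGreatest {j | G.IsKVertexConnected j} k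

end Basic

section CliqueSum

variable {α β α₁ α₂ β₁ β₂ : Type*}

/-- An isomorphism of undirected multigraphs: bijections of the vertex sets and of the edge sets
that respect incidence. -/
structure MultiIso (G : Graph α₁ β₁) (H : Graph α₂ β₂) where
  vertexEquiv : V(G) ≃ V(H)
  edgeEquiv : E(G) ≃ E(H)
  isLink_iff : ∀ (e : E(G)) (x y : V(G)),
    G.IsLink e x y ↔ H.IsLink (edgeEquiv e) (vertexEquiv x) (vertexEquiv y)

/-- The union of disjoint copies of `G₁` and `G₂`. -/
def disjointUnion (G₁ : Graph α₁ β₁) (G₂ : Graph α₂ β₂) : Graph (α₁ ⊕ α₂) (β₁ ⊕ β₂) where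
  vertexSet := Sum.inl '' V(G₁) ∪ Sum.inr '' V(G₂)
  IsLink
    | .inl e, .inl x, .inl y => G₁.IsLink e x y
    | .inr e, .inr x, .inr y => G₂.IsLink e x y
    | _, _, _ => False
  isLink_symm := by
    rintro (e | e) - <;> constructor <;> rintro (x | x) (y | y) h <;>
      first | exact h.elim | exact IsLink.symm h
  eq_or_eq_of_isLink_of_isLink := by
    rintro (e | e) (x | x) (y | y) (v | v) (w | w) h h' <;>
      first | exact h.elim | exact h'.elim | simpa using IsLink.left_eq_or_eq h h'
  left_mem_of_isLink := by
    rintro (e | e) (x | x) (y | y) h <;>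
      first | exact h.elim | simpa using IsLink.left_mem h

open Classical in
/-- The map that contracts `{x₁, x₂}` and `{y₁, y₂}` in a disjoint union; the contracted vertices
are named after `x₁` and `y₁`. -/
noncomputable def glue (x₁ y₁ : α₁) (x₂ y₂ : α₂) : α₁ ⊕ α₂ → α₁ ⊕ α₂
  | .inl v => .inl v
  | .inr v => if v = x₂ then .inl x₁ else if v = y₂ then .inl y₁ else .inr v

/-- The `2`-clique sum at the edges `d₁` (with ends `x₁, y₁`) and `d₂` (with ends `x₂, y₂`), where
`x₁` is identified with `x₂` and `y₁` with `y₂`, and neither `d₁` nor `d₂` is kept. -/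
noncomputable def twoCliqueSum (G₁ : Graph α₁ β₁) (G₂ : Graph α₂ β₂) (d₁ : β₁) (d₂ : β₂)
    (x₁ y₁ : α₁) (x₂ y₂ : α₂) : Graph (α₁ ⊕ α₂) (β₁ ⊕ β₂) :=
  ((disjointUnion G₁ G₂).map (glue x₁ y₁ x₂ y₂)).deleteEdges {.inl d₁, .inr d₂}

/-- `G` is (isomorphic to) a `2`-clique sum of `G₁` and `G₂` at the edges `d₁` and `d₂`, without
remaining edges. -/
def IsTwoCliqueSum (G : Graph α β) (G₁ : Graph α₁ β₁) (G₂ : Graph α₂ β₂) (d₁ : β₁) (d₂ : β₂) :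
    Prop :=
  ∃ x₁ y₁ x₂ y₂, G₁.IsLink d₁ x₁ y₁ ∧ G₂.IsLink d₂ x₂ y₂ ∧
    Nonempty (MultiIso G (twoCliqueSum G₁ G₂ d₁ d₂ x₁ y₁ x₂ y₂))

end CliqueSum

end Graph

/-- A directed graph with a set of arcs and an incidence function (tail, head). -/
structure DirectedMultigraph where
  Vert : Type*
  Arc : Type*
  inc : Arc → Vert × Vert

/-- An isomorphism of directed graphs: bijections of vertices and of arcs respecting incidence. -/
structure DirectedMultigraph.Iso (D D' : DirectedMultigraph) where
  vertEquiv : D.Vert ≃ D'.Vert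
  arcEquiv : D.Arc ≃ D'.Arc
  inc_eq : ∀ a, D'.inc (arcEquiv a) = Prod.map vertEquiv vertEquiv (D.inc a)

namespace Graph

section Exchange

variable {α β : Type*}

/-- `(e, f) ∈ S × T` is a unique exchange: `f` is the only edge of `T` such that exchanging `e` and
`f` gives disjoint spanning trees `(S - e + f, T + e - f)` again. -/
def IsUniqueExchange (G : Graph α β) (S T : Set β) (e f : β) : Prop :=
  e ∈ S ∧ f ∈ T ∧ G.IsTreePair (insert f (S \ {e}), insert e T \ {f}) ∧
    ∀ g ∈ T, G.IsTreePair (insert g (S \ {e}), insert e T \ {g}) → g = f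

/-- The vertices of the exchange graph: the ordered pairs of disjoint spanning trees. -/
def TreePair (G : Graph α β) : Type _ := {p : Set β × Set β // G.IsTreePair p}

/-- `(e, f, S, T)` is an arc of the directed unique exchange graph, where `p = (S, T)`. -/
def IsTauThreeArc (G : Graph α β) (e f : β) (p : G.TreePair) : Prop :=
  G.IsUniqueExchange p.1.1 p.1.2 e f ∨ G.IsUniqueExchange p.1.2 p.1.1 e f

open Classical in
/-- `(S - e + f, T + e - f)` if `e ∈ S`, and `(S + e - f, T - e + f)` otherwise. -/
noncomputable def exchangePair (e f : β) (p : Set β × Set β) : Set β × Set β :=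
  if e ∈ p.1 then (insert f (p.1 \ {e}), insert e p.2 \ {f})
  else (insert e p.1 \ {f}, insert f (p.2 \ {e}))

theorem IsTauThreeArc.isTreePair {G : Graph α β} {e f : β} {p : G.TreePair}
    (h : G.IsTauThreeArc e f p) : G.IsTreePair (exchangePair e f p.1) := by
  rcases h with h | h
  · rw [exchangePair, if_pos h.1]
    exact h.2.2.1
  · rw [exchangePair, if_neg (Set.disjoint_right.1 p.2.2.2.1 h.1)]
    exact h.2.2.1.swap

/-- The tree pair reached from `p` along the arc `(e, f, p)`. -/
noncomputable def IsTauThreeArc.head {G : Graph α β} {e f : β} {p : G.TreePair}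
    (h : G.IsTauThreeArc e f p) : G.TreePair :=
  ⟨exchangePair e f p.1, h.isTreePair⟩

/-- The directed unique exchange graph. -/
noncomputable def tauThree (G : Graph α β) : DirectedMultigraph where
  Vert := G.TreePair
  Arc := {a : β × β × G.TreePair // G.IsTauThreeArc a.1 a.2.1 a.2.2}
  inc a := (a.1.2.2, a.2.head)

theorem IsTauThreeArc.mem_head_of_ne {G : Graph α β} {e f : β} {p : G.TreePair}
    (h : G.IsTauThreeArc e f p) {d : β} (he : e ≠ d) (hf : f ≠ d) :
    (d ∈ h.head.1.1 ↔ d ∈ p.1.1) ∧ (d ∈ h.head.1.2 ↔ d ∈ p.1.2) := by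
  have he' := he.symm
  have hf' := hf.symm
  by_cases hp : e ∈ p.1.1 <;> simp [IsTauThreeArc.head, exchangePair, hp, he', hf']

theorem IsTauThreeArc.mem_head_of_mem {G : Graph α β} {e f : β} {p : G.TreePair}
    (h : G.IsTauThreeArc e f p) {d : β} (hd : d = e ∨ d = f) :
    (d ∈ h.head.1.1 ↔ d ∈ p.1.2) ∧ (d ∈ h.head.1.2 ↔ d ∈ p.1.1) := by
  have hdis := Set.disjoint_left.1 p.2.2.2.1
  rcases h with h | h <;> have h1 := h.1 <;> have h2 := h.2.1
  · have hne : e ≠ f := fun hef => hdis h1 (hef ▸ h2)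
    rcases hd with rfl | rfl
    · simp [IsTauThreeArc.head, exchangePair, h1, hne, hdis h1]
    · have : d ∉ p.1.1 := fun hh => hdis hh h2
      simp [IsTauThreeArc.head, exchangePair, h1, h2, this]
  · have hne : e ≠ f := fun hef => hdis (hef ▸ h2) h1
    have h3 : e ∉ p.1.1 := fun hh => hdis hh h1
    rcases hd with rfl | rfl
    · simp [IsTauThreeArc.head, exchangePair, h1, h3, hne]
    · simp [IsTauThreeArc.head, exchangePair, h3, h2, hdis h2]

end Exchange

section Join

variable {α₁ α₂ β₁ β₂ : Type*}

/-- The condition on `((S₁, T₁), (S₂, T₂))` to be a vertex of the join: not both seam edges in the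
first trees, and not both in the second trees. -/
def SeamSplit (d₁ : β₁) (d₂ : β₂) (p₁ : Set β₁ × Set β₁) (p₂ : Set β₂ × Set β₂) : Prop :=
  ¬ ((d₁ ∈ p₁.1 ∧ d₂ ∈ p₂.1) ∨ (d₁ ∈ p₁.2 ∧ d₂ ∈ p₂.2))

/-- The vertices of the join of the exchange graphs of `G₁` and `G₂` at `d₁` and `d₂`. -/
def JoinVert (G₁ : Graph α₁ β₁) (G₂ : Graph α₂ β₂) (d₁ : β₁) (d₂ : β₂) : Type _ :=
  {q : G₁.TreePair × G₂.TreePair // SeamSplit d₁ d₂ q.1.1 q.2.1}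

/-- `(e, f, q)` is an arc of the join: an exchange in `G₁` or in `G₂` that avoids the seam edge, or
a chain of two exchanges through the seam. -/
def IsJoinArc {G₁ : Graph α₁ β₁} {G₂ : Graph α₂ β₂} (d₁ : β₁) (d₂ : β₂)
    (q : G₁.TreePair × G₂.TreePair) : β₁ ⊕ β₂ → β₁ ⊕ β₂ → Prop
  | .inl e, .inl f => G₁.IsTauThreeArc e f q.1 ∧ ¬ (e = d₁ ∨ f = d₁)
  | .inr e, .inr f => G₂.IsTauThreeArc e f q.2 ∧ ¬ (e = d₂ ∨ f = d₂)
  | .inl e, .inr f => G₁.IsTauThreeArc e d₁ q.1 ∧ G₂.IsTauThreeArc d₂ f q.2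
  | .inr e, .inl f => G₂.IsTauThreeArc e d₂ q.2 ∧ G₁.IsTauThreeArc d₁ f q.1

/-- The end of an arc of the join: the exchange is carried out in the graph that contains `e` and
`f`; if they lie in different graphs, both chained exchanges are carried out. -/
noncomputable def joinHead {G₁ : Graph α₁ β₁} {G₂ : Graph α₂ β₂} {d₁ : β₁} {d₂ : β₂}
    (q : JoinVert G₁ G₂ d₁ d₂) :
    (e f : β₁ ⊕ β₂) → IsJoinArc d₁ d₂ q.1 e f → JoinVert G₁ G₂ d₁ d₂
  | .inl _, .inl _, h => ⟨(h.1.head, q.1.2), by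
      have hm := h.1.mem_head_of_ne (fun hh => h.2 (.inl hh)) (fun hh => h.2 (.inr hh))
      have hq := q.2
      simp only [SeamSplit] at hq ⊢
      rwa [hm.1, hm.2]⟩
  | .inr _, .inr _, h => ⟨(q.1.1, h.1.head), by
      have hm := h.1.mem_head_of_ne (fun hh => h.2 (.inl hh)) (fun hh => h.2 (.inr hh))
      have hq := q.2
      simp only [SeamSplit] at hq ⊢
      rwa [hm.1, hm.2]⟩
  | .inl _, .inr _, h => ⟨(h.1.head, h.2.head), by
      have hm := h.1.mem_head_of_mem (.inr rfl)
      have hm' := h.2.mem_head_of_mem (.inl rfl)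
      have hq := q.2
      simp only [SeamSplit] at hq ⊢
      rwa [hm.1, hm.2, hm'.1, hm'.2, or_comm]⟩
  | .inr _, .inl _, h => ⟨(h.2.head, h.1.head), by
      have hm := h.2.mem_head_of_mem (.inl rfl)
      have hm' := h.1.mem_head_of_mem (.inr rfl)
      have hq := q.2
      simp only [SeamSplit] at hq ⊢
      rwa [hm.1, hm.2, hm'.1, hm'.2, or_comm]⟩

/-- The join of the directed unique exchange graphs of `G₁` and `G₂` at the seam edges `d₁`, `d₂`. -/
noncomputable def tauThreeJoin (G₁ : Graph α₁ β₁) (G₂ : Graph α₂ β₂) (d₁ : β₁) (d₂ : β₂) :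
    DirectedMultigraph where
  Vert := JoinVert G₁ G₂ d₁ d₂
  Arc := {a : (β₁ ⊕ β₂) × (β₁ ⊕ β₂) × JoinVert G₁ G₂ d₁ d₂ //
    IsJoinArc d₁ d₂ a.2.2.1 a.1 a.2.1}
  inc a := (a.1.2.2, joinHead a.1.2.2 a.1.1 a.1.2.1 a.2)

end Join

end Graph

/-! Spanning trees are treated as minimal connecting edge sets (`isSpanningTree_iff`). Everything
rests on one fact about a graph `G` glued from `G₁` and `G₂` along the seam edges `d₁`, `d₂`
(`IsAmalgam.isMinConnecting_iff`): an edge set with traces `U₁`, `U₂` is a spanning tree of `G`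
exactly when one trace is a spanning tree of its part and the other becomes one after its seam edge
is added.

If both parts are bispanning, counting edges shows that the two trees of a tree pair of `G` make
opposite choices here. So tree pairs of `G` correspond to pairs of tree pairs of the parts in which
`d₁` and `d₂` lie on opposite sides (`IsAmalgam.glueVert_bijective`). Under this correspondence an
exchange inside one part that avoids the seam stays an exchange, and an exchange of `e` in `G₁` with
`f` in `G₂` is a chain: `e` for `d₁`, then `d₂` for `f` (`IsAmalgam.isExchange_across`). Uniqueness
also transfers. An exchange of `e` with `d₁` can always be continued in `G₂` by the symmetric
exchange property, so a competitor `d₁` in `G₁` yields a competitor in `G`, and conversely. Arcs and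
their heads then match.

For the decomposition, an atomic bispanning graph on more than two vertices is simple, and a simple
bispanning graph does not have three vertices. Connectivity 2 therefore comes from a separating pair
`x`, `y`. Cut there and add a seam edge to each side. If both trees of a tree pair made the same
choice, one side would be a proper bispanning subgraph, against atomicity. An edge of `G` from `x`
to `y` is excluded likewise: it could play the seam edge of the side that does not contain it. So
both sides are simple and bispanning. -/

namespace Graph

/-! ### Walks inside an edge set, connecting edge sets, and spanning trees as minimal ones. -/

section Reach

variable {α β : Type*} {G : Graph α β} {U W R S T : Set β} {e f g : β} {x y z u v : α}

/-- `x` and `y` are joined by a walk all of whose edges lie in `U`. -/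
def Reach (G : Graph α β) (U : Set β) : α → α → Prop :=
  Relation.ReflTransGen fun a b => ∃ e ∈ U, G.IsLink e a b

theorem Reach.refl (G : Graph α β) (U : Set β) (x : α) : G.Reach U x x :=
  Relation.ReflTransGen.refl

theorem Reach.trans (h : G.Reach U x y) (h' : G.Reach U y z) : G.Reach U x z :=
  Relation.ReflTransGen.trans h h'

theorem IsLink.reach (h : G.IsLink e x y) (he : e ∈ U) : G.Reach U x y :=
  Relation.ReflTransGen.single ⟨e, he, h⟩

theorem Reach.symm (h : G.Reach U x y) : G.Reach U y x := by
  induction h with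
  | refl => exact .refl _ _ _
  | tail _ h ih =>
    obtain ⟨e, he, h⟩ := h
    exact (h.symm.reach he).trans ih

/-- A walk whose edges can all be replaced by walks in `W`. -/
theorem Reach.subst (h : G.Reach U x y)
    (hW : ∀ e ∈ U, ∀ a b, G.IsLink e a b → G.Reach W a b) : G.Reach W x y := by
  induction h with
  | refl => exact .refl _ _ _
  | tail _ h ih =>
    obtain ⟨e, he, h⟩ := h
    exact ih.trans (hW e he _ _ h)

theorem Reach.mono (h : G.Reach U x y) (hUW : U ⊆ W) : G.Reach W x y :=
  h.subst fun _ he _ _ hl => hl.reach (hUW he)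

theorem Reach.of_insert (h : G.Reach (insert e R) x y) (he : G.IsLink e u v) (hRW : R ⊆ W)
    (huv : G.Reach W u v) : G.Reach W x y := by
  refine h.subst ?_
  rintro f (rfl | hf) a b hab
  · obtain ⟨rfl, rfl⟩ | ⟨rfl, rfl⟩ := he.eq_and_eq_or_eq_and_eq hab
    · exact huv
    · exact huv.symm
  · exact hab.reach (hRW hf)

theorem Reach.right_mem (h : G.Reach U x y) (hx : x ∈ V(G)) : y ∈ V(G) := by
  induction h with
  | refl => exact hx
  | tail _ h _ => exact h.choose_spec.2.right_mem

/-- Repeated passages through `e` cancel, so a walk needs `e` at most once, in one of the two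
directions. -/
theorem Reach.insert_cases (h : G.Reach (insert e R) x y) (he : G.IsLink e u v) :
    G.Reach R x y ∨ (G.Reach R x u ∧ G.Reach R v y) ∨ (G.Reach R x v ∧ G.Reach R u y) := by
  induction h with
  | refl => exact .inl (.refl _ _ _)
  | tail _ h ih =>
    obtain ⟨f, rfl | hf, h⟩ := h
    · obtain ⟨rfl, rfl⟩ | ⟨rfl, rfl⟩ := he.eq_and_eq_or_eq_and_eq h
      · rcases ih with ih | ih | ih
        · exact .inr (.inl ⟨ih, .refl _ _ _⟩)
        · exact .inr (.inl ⟨ih.1, .refl _ _ _⟩)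
        · exact .inl ih.1
      · rcases ih with ih | ih | ih
        · exact .inr (.inr ⟨ih, .refl _ _ _⟩)
        · exact .inl ih.1
        · exact .inr (.inr ⟨ih.1, .refl _ _ _⟩)
    · have hr := h.reach hf
      exact ih.imp (·.trans hr) (Or.imp (fun k => ⟨k.1, k.2.trans hr⟩) (fun k => ⟨k.1, k.2.trans hr⟩))

/-- Allows induction on the edge set of a walk although `U` may be infinite. -/
theorem Reach.exists_finset (h : G.Reach U x y) : ∃ F : Finset β, ↑F ⊆ U ∧ G.Reach F x y := by
  classical
  induction h with
  | refl => exact ⟨∅, by simp, .refl _ _ _⟩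
  | tail _ h ih =>
    obtain ⟨e, he, h⟩ := h
    obtain ⟨F, hF, hr⟩ := ih
    exact ⟨insert e F, by simp [Set.insert_subset_iff, he, hF],
      (hr.mono (by simp)).trans (h.reach (by simp))⟩

theorem Reach.exists_crossing (h : G.Reach U x y) (P : α → Prop) (hx : P x) (hy : ¬ P y) :
    ∃ f ∈ U, ∃ u v, G.IsLink f u v ∧ P u ∧ ¬ P v := by
  by_contra! hc
  refine hy ?_
  clear hy
  induction h with
  | refl => exact hx
  | tail _ h ih =>
    obtain ⟨e, he, h⟩ := h
    exact hc e he _ _ h ih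

/-- A walk from inside `P` to outside `P` can be chosen as a path, and it then has an edge `f`
that leaves `P` and cuts it into two walks avoiding `f`. -/
theorem Reach.exists_crossing_cut (h : G.Reach U x y) (P : α → Prop) (hx : P x) (hy : ¬ P y) :
    ∃ f ∈ U, ∃ u v, G.IsLink f u v ∧ P u ∧ ¬ P v ∧
      ((G.Reach (U \ {f}) x u ∧ G.Reach (U \ {f}) v y) ∨
        (G.Reach (U \ {f}) x v ∧ G.Reach (U \ {f}) u y)) := by
  classical
  obtain ⟨F, hFU, hF⟩ := h.exists_finset
  induction F using Finset.strongInduction with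
  | H F ih =>
    obtain ⟨f, hf, u, v, hl, hu, hv⟩ := hF.exists_crossing P hx hy
    -- If `f` is dispensable, pass to the smaller set. Otherwise every walk in `F` from `x` to `y`
    -- uses `f`, and cutting at `f` gives the two required pieces.
    by_cases hr : G.Reach (F.erase f : Finset β) x y
    · exact ih _ (Finset.erase_ssubset hf)
        ((Finset.coe_subset.2 (Finset.erase_subset _ _)).trans hFU) hr
    · have hs : ((F.erase f : Finset β) : Set β) ⊆ U \ {f} := by
        rw [Finset.coe_erase]
        exact Set.sdiff_subset_sdiff_left hFU
      refine ⟨f, hFU hf, u, v, hl, hu, hv, ?_⟩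
      have hF' : G.Reach (insert f ((F.erase f : Finset β) : Set β)) x y := by
        rwa [← Finset.coe_insert, Finset.insert_erase hf]
      exact ((hF'.insert_cases hl).resolve_left hr).imp
        (fun k => ⟨k.1.mono hs, k.2.mono hs⟩) (fun k => ⟨k.1.mono hs, k.2.mono hs⟩)

/-- The graph `(V(G), U)` is connected. -/
def Connects (G : Graph α β) (U : Set β) : Prop :=
  V(G).Nonempty ∧ ∀ x ∈ V(G), ∀ y ∈ V(G), G.Reach U x y

theorem Connects.mono (h : G.Connects U) (hUW : U ⊆ W) : G.Connects W :=
  ⟨h.1, fun x hx y hy => (h.2 x hx y hy).mono hUW⟩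

theorem Connects.of_insert (h : G.Connects (insert e R)) (he : G.IsLink e u v) (hRW : R ⊆ W)
    (huv : G.Reach W u v) : G.Connects W :=
  ⟨h.1, fun x hx y hy => (h.2 x hx y hy).of_insert he hRW huv⟩

theorem Connects.of_sdiff (h : G.Connects U) (he : G.IsLink e u v) (hRW : U \ {e} ⊆ W)
    (huv : G.Reach W u v) : G.Connects W := by
  refine Connects.of_insert (e := e) (R := U \ {e}) (h.mono ?_) he hRW huv
  simp

/-- Minimal connecting edge sets, the usual description of spanning trees. -/
structure IsMinConnecting (G : Graph α β) (T : Set β) : Prop where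
  subset_edgeSet : T ⊆ E(G)
  connects : G.Connects T
  not_connects : ∀ e ∈ T, ¬ G.Connects (T \ {e})

theorem IsMinConnecting.not_reach (h : G.IsMinConnecting T) (he : e ∈ T) (hl : G.IsLink e x y) :
    ¬ G.Reach (T \ {e}) x y :=
  fun hr => h.not_connects e he (h.connects.of_sdiff hl subset_rfl hr)

theorem IsMinConnecting.eq_of_subset (h : G.IsMinConnecting T) (hU : G.Connects U) (hUT : U ⊆ T) :
    U = T := by
  refine hUT.antisymm fun e he => ?_
  by_contra hne
  exact h.not_connects e he (hU.mono fun f hf => ⟨hUT hf, fun hfe => hne (hfe ▸ hf)⟩)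

theorem IsMinConnecting.insert_sdiff (h : G.IsMinConnecting T) (hf : f ∈ T) (he : e ∈ E(G))
    (heT : e ∉ T) (hc : G.Connects (insert e (T \ {f}))) :
    G.IsMinConnecting (insert e (T \ {f})) := by
  obtain ⟨u, v, huv⟩ := exists_isLink_of_mem_edgeSet (h.subset_edgeSet hf)
  obtain ⟨x, y, hxy⟩ := exists_isLink_of_mem_edgeSet he
  refine ⟨?_, hc, ?_⟩
  · rintro g (rfl | hg)
    exacts [he, h.subset_edgeSet hg.1]
  · rintro g (rfl | hg) hcon
    · exact h.not_connects f hf (hcon.mono (by grind))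
    · have hcon' : G.Connects (insert e ((T \ {f}) \ {g})) := hcon.mono (by grind)
      -- If the new set is not minimal at `g`, it still joins the ends of `f`. Without `e` this
      -- makes `f` redundant in `T`. With `e`, the walk together with `f` closes a cycle through
      -- `e`, so `T \ {g}` already joins the ends of `e`.
      have hr := hcon'.2 u huv.left_mem v huv.right_mem
      have hfg : f ∈ T \ {g} := ⟨hf, by grind⟩
      have hs : (T \ {f}) \ {g} ⊆ T \ {g} := by grind
      rcases hr.insert_cases hxy with hr | hr | hr
      · exact h.not_reach hf huv (hr.mono (by grind))
      · refine h.not_connects g hg.1 (hcon'.of_insert hxy hs ?_)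
        exact (hr.1.mono hs).symm.trans ((huv.reach hfg).trans (hr.2.mono hs).symm)
      · refine h.not_connects g hg.1 (hcon'.of_insert hxy hs ?_)
        exact (hr.2.mono hs).trans ((huv.symm.reach hfg).trans (hr.1.mono hs))

theorem IsMinConnecting.reach_or_reach (h : G.IsMinConnecting T) (hl : G.IsLink e x y)
    (hz : z ∈ V(G)) : G.Reach (T \ {e}) x z ∨ G.Reach (T \ {e}) y z := by
  have hr : G.Reach (insert e (T \ {e})) x z := (h.connects.2 x hl.left_mem z hz).mono (by simp)
  rcases hr.insert_cases hl with hr | hr | hr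
  exacts [.inl hr, .inr hr.2, .inl hr.2]

/-- Symmetric exchange of edges between two spanning trees. -/
theorem IsMinConnecting.exists_exchange (hS : G.IsMinConnecting S) (hT : G.IsMinConnecting T)
    (heS : e ∈ S) (heT : e ∉ T) :
    ∃ f ∈ T, f ∉ S ∧ G.IsMinConnecting (insert f (S \ {e})) ∧
      G.IsMinConnecting (insert e (T \ {f})) := by
  have heE := hS.subset_edgeSet heS
  obtain ⟨x, y, hxy⟩ := exists_isLink_of_mem_edgeSet heE
  have hnr := hS.not_reach heS hxy
  -- One edge `f` serves both trees: it leaves the component of `x` in `S \ {e}`, so it reconnects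
  -- `S`, and it cuts the walk of `T` from `x` to `y`, so `e` can replace it in `T`.
  obtain ⟨f, hf, u, v, huv, hu, hv, hcut⟩ :=
    (hT.connects.2 x hxy.left_mem y hxy.right_mem).exists_crossing_cut
      (fun w => G.Reach (S \ {e}) x w) (.refl _ _ _) hnr
  have hfe : f ≠ e := by grind
  have hfS : f ∉ S := fun hfS => hv (hu.trans (huv.reach ⟨hfS, hfe⟩))
  refine ⟨f, hf, hfS, hS.insert_sdiff heS (hT.subset_edgeSet hf) hfS ?_,
    hT.insert_sdiff hf heE heT ?_⟩
  · refine hS.connects.of_sdiff hxy (Set.subset_insert _ _) ?_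
    have hyv := (hS.reach_or_reach hxy huv.right_mem).resolve_left hv
    exact (hu.mono (Set.subset_insert _ _)).trans
      ((huv.reach (Set.mem_insert _ _)).trans (hyv.symm.mono (Set.subset_insert _ _)))
  · refine hT.connects.of_sdiff huv (Set.subset_insert _ _) ?_
    have hs : T \ {f} ⊆ insert e (T \ {f}) := Set.subset_insert _ _
    have he := hxy.reach (Set.mem_insert e (T \ {f}))
    rcases hcut with h | h
    · exact (h.1.mono hs).symm.trans (he.trans (h.2.mono hs).symm)
    · exact (h.2.mono hs).trans (he.symm.trans (h.1.mono hs))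

/-- Each exchange brings `S` one edge closer to `T` without changing its size. This stands in for
the formula that counts vertices minus one. -/
theorem IsMinConnecting.ncard_eq (hS : G.IsMinConnecting S) (hT : G.IsMinConnecting T)
    (hfin : S.Finite) : S.ncard = T.ncard := by
  obtain ⟨n, hn⟩ : ∃ n, (S \ T).ncard = n := ⟨_, rfl⟩
  induction n generalizing S with
  | zero =>
    have : S \ T = ∅ := (Set.ncard_eq_zero hfin.sdiff).1 hn
    rw [hT.eq_of_subset hS.connects (Set.sdiff_eq_empty.1 this)]
  | succ n ih =>
    obtain ⟨e, heS, heT⟩ : (S \ T).Nonempty := Set.nonempty_of_ncard_ne_zero (by omega)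
    obtain ⟨f, hfT, hfS, hf, -⟩ := hS.exists_exchange hT heS heT
    have hfin' : (insert f (S \ {e})).Finite := hfin.sdiff.insert f
    rw [← ih hf hfin', Set.ncard_insert_of_notMem (fun h => hfS h.1) hfin.sdiff,
      Set.ncard_sdiff_singleton_add_one heS hfin]
    have : insert f (S \ {e}) \ T = (S \ T) \ {e} := by grind
    rw [this]
    have := Set.ncard_sdiff_singleton_add_one (show e ∈ S \ T from ⟨heS, heT⟩) hfin.sdiff
    omega

/-- A new edge can replace some edge of a spanning edge set. -/
theorem Connects.exists_insert_sdiff (h : G.Connects U) (hl : G.IsLink e x y) (hxy : x ≠ y) :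
    ∃ f ∈ U, G.Connects (insert e (U \ {f})) := by
  obtain ⟨f, hf, u, v, huv, -, -, hcut⟩ :=
    (h.2 x hl.left_mem y hl.right_mem).exists_crossing_cut (· = x) rfl hxy.symm
  refine ⟨f, hf, h.of_sdiff huv (Set.subset_insert _ _) ?_⟩
  have hs : U \ {f} ⊆ insert e (U \ {f}) := Set.subset_insert _ _
  have he := hl.reach (Set.mem_insert e (U \ {f}))
  rcases hcut with h | h
  · exact (h.1.mono hs).symm.trans (he.trans (h.2.mono hs).symm)
  · exact (h.2.mono hs).trans (he.symm.trans (h.1.mono hs))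

theorem reach_iff_reachable (G : Graph α β) (U : Set β) (x y : V(G)) :
    G.Reach U x y ↔ (G.restrict U).toSimpleGraph.Reachable x y := by
  constructor
  · intro h
    obtain ⟨y, hy⟩ := y
    change G.Reach U x y at h
    induction h with
    | refl => exact .refl _
    | @tail b c _ h ih =>
      obtain ⟨e, he, h⟩ := h
      refine (ih h.left_mem).trans ?_
      by_cases hbc : b = c
      · subst hbc
        exact .refl _
      · exact SimpleGraph.Adj.reachable ⟨fun hh => hbc (congrArg Subtype.val hh), e, he, h⟩
  · intro h
    replace h := (SimpleGraph.reachable_iff_reflTransGen _ _).1 h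
    induction h with
    | refl => exact .refl _ _ _
    | tail _ h ih =>
      obtain ⟨-, e, he, h⟩ := h
      exact ih.trans (IsLink.reach h he)

theorem connects_iff_connected (G : Graph α β) (U : Set β) :
    G.Connects U ↔ (G.restrict U).toSimpleGraph.Connected := by
  rw [SimpleGraph.connected_iff]
  constructor
  · exact fun h => ⟨fun x y => (reach_iff_reachable G U x y).1 (h.2 x x.2 y y.2),
      Set.nonempty_coe_sort.2 h.1⟩
  · exact fun h => ⟨Set.nonempty_coe_sort.1 h.2,
      fun x hx y hy => (reach_iff_reachable G U ⟨x, hx⟩ ⟨y, hy⟩).2 (h.1 _ _)⟩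

theorem isConnected_iff_connects (G : Graph α β) : G.IsConnected ↔ G.Connects E(G) := by
  rw [connects_iff_connected, restrict_self, IsConnected]

/-- Simplicity matters: only when `e` has no parallel edge in `T` does deleting it remove the
adjacency from the underlying simple graph. -/
theorem reach_sdiff_iff_reachable [(G.restrict T).Simple] (he : e ∈ T) {x y : V(G)}
    (hl : G.IsLink e x y) : G.Reach (T \ {e}) x y ↔
      ((G.restrict T).toSimpleGraph \ SimpleGraph.fromEdgeSet {s(x, y)}).Reachable x y := by
  rw [reach_iff_reachable]
  suffices h : (G.restrict (T \ {e})).toSimpleGraph =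
      (G.restrict T).toSimpleGraph \ SimpleGraph.fromEdgeSet {s(x, y)} by
    rw [h]
    exact Iff.rfl
  have hl' : (G.restrict T).IsLink e x y := ⟨he, hl⟩
  ext a b
  constructor
  · rintro ⟨hab, f, hf, hfl⟩
    refine ⟨⟨hab, f, hf.1, hfl⟩, fun hs => hf.2 ?_⟩
    have hfl' : (G.restrict T).IsLink f a b := ⟨hf.1, hfl⟩
    have hs' : s(a, b) = s(x, y) := hs.1
    rcases Sym2.eq_iff.1 hs' with ⟨rfl, rfl⟩ | ⟨rfl, rfl⟩
    exacts [hfl'.eq hl', hfl'.symm.eq hl']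
  · rintro ⟨⟨hab, f, hf, hfl⟩, hs⟩
    refine ⟨hab, f, ⟨hf, ?_⟩, hfl⟩
    rintro rfl
    refine hs ⟨?_, hab⟩
    rcases hl.eq_and_eq_or_eq_and_eq hfl with h | h
    · exact Sym2.eq_iff.2 (.inl ⟨Subtype.ext h.1.symm, Subtype.ext h.2.symm⟩)
    · exact Sym2.eq_iff.2 (.inr ⟨Subtype.ext h.2.symm, Subtype.ext h.1.symm⟩)

theorem IsMinConnecting.simple_restrict (h : G.IsMinConnecting T) : (G.restrict T).Simple where
  not_isLoopAt e x hl := h.not_reach hl.1 hl.2 (.refl _ _ _)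
  eq_of_isLink e f x y he hf := by
    by_contra hne
    exact h.not_reach he.1 he.2 (hf.2.reach ⟨hf.1, fun hh => hne hh.symm⟩)

/-- A graph is acyclic when all its edges are bridges, and in a connected graph an edge is a bridge
exactly when it cannot be dropped. Loops and parallel edges are never indispensable, which accounts
for simplicity. -/
theorem isSpanningTree_iff : G.IsSpanningTree T ↔ G.IsMinConnecting T := by
  have key (_ : (G.restrict T).Simple) : (G.restrict T).toSimpleGraph.IsAcyclic ↔
      ∀ e ∈ T, ∀ x y, G.IsLink e x y → ¬ G.Reach (T \ {e}) x y := by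
    rw [SimpleGraph.isAcyclic_iff_forall_adj_isBridge]
    constructor
    · intro h e he x y hl hr
      have hl' : (G.restrict T).IsLink e x y := ⟨he, hl⟩
      have hadj : (G.restrict T).toSimpleGraph.Adj ⟨x, hl.left_mem⟩ ⟨y, hl.right_mem⟩ :=
        ⟨fun hh => hl'.ne (congrArg Subtype.val hh), e, hl'⟩
      have := SimpleGraph.isBridge_iff.1 (h hadj)
      exact this
        ((reach_sdiff_iff_reachable (x := ⟨x, hl.left_mem⟩) (y := ⟨y, hl.right_mem⟩) he hl).1 hr)
    · rintro h x y ⟨hne, e, he, hl⟩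
      exact SimpleGraph.isBridge_iff.2
        fun hr => h e he x y hl ((reach_sdiff_iff_reachable he hl).2 hr)
  constructor
  · rintro ⟨hTE, hs, ht⟩
    refine ⟨hTE, (connects_iff_connected G T).2 ht.1, fun e he hc => ?_⟩
    obtain ⟨x, y, hl⟩ := exists_isLink_of_mem_edgeSet (hTE he)
    exact (key hs).1 ht.2 e he x y hl (hc.2 x hl.left_mem y hl.right_mem)
  · intro h
    exact ⟨h.subset_edgeSet, h.simple_restrict, (connects_iff_connected G T).1 h.connects,
      (key h.simple_restrict).2 fun e he x y hl => h.not_reach he hl⟩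

end Reach

end Graph

namespace Graph

/-! ### Connecting sets and spanning trees of a graph glued along two seam edges. -/

section Amalgam

variable {α β α₁ α₂ β₁ β₂ : Type*}

/-- `G` arises from `G₁` and `G₂` by gluing along the non-loops `d₁ = x₁y₁` and `d₂ = x₂y₂` and
deleting these two edges; `φᵢ` and `ψᵢ` place the vertices and the remaining edges of `Gᵢ`. -/
structure IsAmalgam (G : Graph α β) (G₁ : Graph α₁ β₁) (G₂ : Graph α₂ β₂) (d₁ : β₁) (d₂ : β₂)
    (x₁ y₁ : α₁) (x₂ y₂ : α₂) (φ₁ : α₁ → α) (φ₂ : α₂ → α) (ψ₁ : β₁ → β) (ψ₂ : β₂ → β) :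
    Prop where
  isLink₁ : G₁.IsLink d₁ x₁ y₁
  isLink₂ : G₂.IsLink d₂ x₂ y₂
  ne₁ : x₁ ≠ y₁
  ne₂ : x₂ ≠ y₂
  injOn_vert₁ : Set.InjOn φ₁ V(G₁)
  injOn_vert₂ : Set.InjOn φ₂ V(G₂)
  map_left : φ₁ x₁ = φ₂ x₂
  map_right : φ₁ y₁ = φ₂ y₂
  overlap : ∀ a ∈ V(G₁), ∀ b ∈ V(G₂), φ₁ a = φ₂ b → (a = x₁ ∧ b = x₂) ∨ (a = y₁ ∧ b = y₂)
  vertexSet_eq : V(G) = φ₁ '' V(G₁) ∪ φ₂ '' V(G₂)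
  injOn_edge₁ : Set.InjOn ψ₁ (E(G₁) \ {d₁})
  injOn_edge₂ : Set.InjOn ψ₂ (E(G₂) \ {d₂})
  edge_ne : ∀ e ∈ E(G₁) \ {d₁}, ∀ f ∈ E(G₂) \ {d₂}, ψ₁ e ≠ ψ₂ f
  isLink_map₁ : ∀ f a b, f ≠ d₁ → G₁.IsLink f a b → G.IsLink (ψ₁ f) (φ₁ a) (φ₁ b)
  isLink_map₂ : ∀ f a b, f ≠ d₂ → G₂.IsLink f a b → G.IsLink (ψ₂ f) (φ₂ a) (φ₂ b)
  exists_of_mem : ∀ e ∈ E(G),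
    (∃ f ∈ E(G₁) \ {d₁}, ψ₁ f = e) ∨ (∃ f ∈ E(G₂) \ {d₂}, ψ₂ f = e)

namespace IsAmalgam

variable {G : Graph α β} {G₁ : Graph α₁ β₁} {G₂ : Graph α₂ β₂} {d₁ : β₁} {d₂ : β₂}
    {x₁ y₁ : α₁} {x₂ y₂ : α₂} {φ₁ : α₁ → α} {φ₂ : α₂ → α} {ψ₁ : β₁ → β} {ψ₂ : β₂ → β}
    {U₁ W₁ : Set β₁} {U₂ : Set β₂}

theorem symm (h : IsAmalgam G G₁ G₂ d₁ d₂ x₁ y₁ x₂ y₂ φ₁ φ₂ ψ₁ ψ₂) :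
    IsAmalgam G G₂ G₁ d₂ d₁ x₂ y₂ x₁ y₁ φ₂ φ₁ ψ₂ ψ₁ where
  isLink₁ := h.isLink₂
  isLink₂ := h.isLink₁
  ne₁ := h.ne₂
  ne₂ := h.ne₁
  injOn_vert₁ := h.injOn_vert₂
  injOn_vert₂ := h.injOn_vert₁
  map_left := h.map_left.symm
  map_right := h.map_right.symm
  overlap a ha b hb hab := (h.overlap b hb a ha hab.symm).imp And.symm And.symm
  vertexSet_eq := by rw [h.vertexSet_eq, Set.union_comm]
  injOn_edge₁ := h.injOn_edge₂
  injOn_edge₂ := h.injOn_edge₁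
  edge_ne e he f hf hef := h.edge_ne f hf e he hef.symm
  isLink_map₁ := h.isLink_map₂
  isLink_map₂ := h.isLink_map₁
  exists_of_mem e he := (h.exists_of_mem e he).symm

theorem isLink_of_image (h : IsAmalgam G G₁ G₂ d₁ d₂ x₁ y₁ x₂ y₂ φ₁ φ₂ ψ₁ ψ₂)
    {f : β₁} (hf : f ∈ E(G₁) \ {d₁}) {z w : α} (hl : G.IsLink (ψ₁ f) z w) :
    ∃ a b, G₁.IsLink f a b ∧ φ₁ a = z ∧ φ₁ b = w := by
  obtain ⟨a, b, hab⟩ := exists_isLink_of_mem_edgeSet hf.1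
  obtain ⟨rfl, rfl⟩ | ⟨rfl, rfl⟩ := (h.isLink_map₁ f a b hf.2 hab).eq_and_eq_or_eq_and_eq hl
  exacts [⟨a, b, hab, rfl, rfl⟩, ⟨b, a, hab.symm, rfl, rfl⟩]

theorem edgeSet_eq (h : IsAmalgam G G₁ G₂ d₁ d₂ x₁ y₁ x₂ y₂ φ₁ φ₂ ψ₁ ψ₂) :
    E(G) = ψ₁ '' (E(G₁) \ {d₁}) ∪ ψ₂ '' (E(G₂) \ {d₂}) := by
  ext e
  constructor
  · intro he
    exact h.exists_of_mem e he
  · rintro (⟨f, hf, rfl⟩ | ⟨f, hf, rfl⟩)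
    · obtain ⟨a, b, hab⟩ := exists_isLink_of_mem_edgeSet hf.1
      exact (h.isLink_map₁ f a b hf.2 hab).edge_mem
    · obtain ⟨a, b, hab⟩ := exists_isLink_of_mem_edgeSet hf.1
      exact (h.isLink_map₂ f a b hf.2 hab).edge_mem

theorem reach_map (h : IsAmalgam G G₁ G₂ d₁ d₂ x₁ y₁ x₂ y₂ φ₁ φ₂ ψ₁ ψ₂) {U : Set β}
    (hU : ∀ f ∈ U₁, f ≠ d₁ → ψ₁ f ∈ U) (hd : d₁ ∈ U₁ → G.Reach U (φ₁ x₁) (φ₁ y₁)) {a b : α₁}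
    (hr : G₁.Reach U₁ a b) : G.Reach U (φ₁ a) (φ₁ b) := by
  induction hr with
  | refl => exact .refl _ _ _
  | tail _ hl ih =>
    obtain ⟨f, hf, hl⟩ := hl
    refine ih.trans ?_
    by_cases hfd : f = d₁
    · subst hfd
      obtain ⟨rfl, rfl⟩ | ⟨rfl, rfl⟩ := h.isLink₁.eq_and_eq_or_eq_and_eq hl
      exacts [hd hf, (hd hf).symm]
    · exact (h.isLink_map₁ f _ _ hfd hl).reach (hU f hf hfd)

/-- A walk between vertices of `G₁` can be replaced by one in `G₁`, if any passage through `G₂` can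
be replaced. -/
theorem reach_of_reach (h : IsAmalgam G G₁ G₂ d₁ d₂ x₁ y₁ x₂ y₂ φ₁ φ₂ ψ₁ ψ₂)
    (hU₁ : U₁ ⊆ E(G₁) \ {d₁}) (hU₂ : U₂ ⊆ E(G₂) \ {d₂}) (hUW : U₁ ⊆ W₁)
    (hxy : G₂.Reach U₂ x₂ y₂ → G₁.Reach W₁ x₁ y₁) {a b : α₁} (ha : a ∈ V(G₁)) (hb : b ∈ V(G₁))
    (hr : G.Reach (ψ₁ '' U₁ ∪ ψ₂ '' U₂) (φ₁ a) (φ₁ b)) : G₁.Reach W₁ a b := by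
  -- The induction must follow the walk into `G₂` as well. There the invariant records the seam end
  -- through which `G₂` can be left again, and that this end has been reached inside `G₁`.
  suffices key : ∀ z, G.Reach (ψ₁ '' U₁ ∪ ψ₂ '' U₂) (φ₁ a) z →
      (∀ b ∈ V(G₁), φ₁ b = z → G₁.Reach W₁ a b) ∧
      (∀ c ∈ V(G₂), φ₂ c = z → (G₂.Reach U₂ c x₂ ∧ G₁.Reach W₁ a x₁) ∨
        (G₂.Reach U₂ c y₂ ∧ G₁.Reach W₁ a y₁)) from (key _ hr).1 b hb rfl
  have h₁ : ∀ b ∈ V(G₁), G₁.Reach W₁ a b → ∀ c ∈ V(G₂), φ₂ c = φ₁ b →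
      (G₂.Reach U₂ c x₂ ∧ G₁.Reach W₁ a x₁) ∨ (G₂.Reach U₂ c y₂ ∧ G₁.Reach W₁ a y₁) := by
    intro b hb hab c hc hcb
    obtain ⟨rfl, rfl⟩ | ⟨rfl, rfl⟩ := h.overlap b hb c hc hcb.symm
    exacts [.inl ⟨.refl _ _ _, hab⟩, .inr ⟨.refl _ _ _, hab⟩]
  intro z hz
  induction hz with
  | refl =>
    refine ⟨fun b hb hab => ?_, fun c hc hca => h₁ a ha (.refl _ _ _) c hc hca⟩
    rw [h.injOn_vert₁ hb ha hab]
    exact .refl _ _ _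
  | tail _ hl ih =>
    obtain ⟨e, ⟨f, hf, rfl⟩ | ⟨f, hf, rfl⟩, hl⟩ := hl
    · obtain ⟨u, v, huv, rfl, rfl⟩ := h.isLink_of_image (hU₁ hf) hl
      have hv := (ih.1 u huv.left_mem rfl).trans (huv.reach (hUW hf))
      refine ⟨fun b hb hbv => ?_, fun c hc hcv => h₁ v huv.right_mem hv c hc hcv⟩
      rwa [h.injOn_vert₁ hb huv.right_mem hbv]
    · obtain ⟨u, v, huv, rfl, rfl⟩ := h.symm.isLink_of_image (hU₂ hf) hl
      have hvu : G₂.Reach U₂ v u := huv.symm.reach hf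
      have hv := (ih.2 u huv.left_mem rfl).imp (fun k => (⟨hvu.trans k.1, k.2⟩ : _ ∧ _))
        (fun k => (⟨hvu.trans k.1, k.2⟩ : _ ∧ _))
      refine ⟨fun b hb hbv => ?_, fun c hc hcv => ?_⟩
      -- Back in `G₁` at a seam end: either it is the recorded one, or the walk has crossed `G₂`
      -- between the two ends and `hxy` supplies the detour.
      · obtain ⟨rfl, rfl⟩ | ⟨rfl, rfl⟩ := h.overlap b hb v huv.right_mem hbv
        · exact hv.elim And.right fun k => k.2.trans (hxy k.1).symm
        · exact hv.elim (fun k => k.2.trans (hxy k.1.symm)) And.right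
      · rwa [h.injOn_vert₂ hc huv.right_mem hcv]

/-- Since `U₁` joins the ends of the seam, it replaces `d₂` in every walk of `G₂`. -/
theorem connects_of_connects (h : IsAmalgam G G₁ G₂ d₁ d₂ x₁ y₁ x₂ y₂ φ₁ φ₂ ψ₁ ψ₂)
    (hU₁ : U₁ ⊆ E(G₁) \ {d₁}) (hc₁ : G₁.Connects U₁) (hc₂ : G₂.Connects (insert d₂ U₂)) :
    G.Connects (ψ₁ '' U₁ ∪ ψ₂ '' U₂) := by
  have hx₁ := h.isLink₁.left_mem
  have hx₂ := h.isLink₂.left_mem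
  have hr₁ : ∀ a ∈ V(G₁), G.Reach (ψ₁ '' U₁ ∪ ψ₂ '' U₂) (φ₁ x₁) (φ₁ a) := fun a ha =>
    h.reach_map (fun f hf _ => .inl ⟨f, hf, rfl⟩) (fun hd => absurd rfl (hU₁ hd).2)
      (hc₁.2 x₁ hx₁ a ha)
  have hr₂ : ∀ a ∈ V(G₂), G.Reach (ψ₁ '' U₁ ∪ ψ₂ '' U₂) (φ₁ x₁) (φ₂ a) := fun a ha => by
    rw [h.map_left]
    refine h.symm.reach_map (fun f hf hfd => .inr ⟨f, hf.resolve_left hfd, rfl⟩) (fun _ => ?_)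
      (hc₂.2 x₂ hx₂ a ha)
    rw [← h.map_left, ← h.map_right]
    exact hr₁ y₁ h.isLink₁.right_mem
  have hr : ∀ z ∈ V(G), G.Reach (ψ₁ '' U₁ ∪ ψ₂ '' U₂) (φ₁ x₁) z := by
    rw [h.vertexSet_eq]
    rintro z (⟨a, ha, rfl⟩ | ⟨a, ha, rfl⟩)
    exacts [hr₁ a ha, hr₂ a ha]
  refine ⟨⟨φ₁ x₁, ?_⟩, fun z hz w hw => (hr z hz).symm.trans (hr w hw)⟩
  rw [h.vertexSet_eq]
  exact .inl ⟨x₁, hx₁, rfl⟩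

/-- Any passage of a walk through `G₂` is replaced by `d₁`. -/
theorem connects_insert (h : IsAmalgam G G₁ G₂ d₁ d₂ x₁ y₁ x₂ y₂ φ₁ φ₂ ψ₁ ψ₂)
    (hU₁ : U₁ ⊆ E(G₁) \ {d₁}) (hU₂ : U₂ ⊆ E(G₂) \ {d₂})
    (hc : G.Connects (ψ₁ '' U₁ ∪ ψ₂ '' U₂)) : G₁.Connects (insert d₁ U₁) := by
  refine ⟨⟨x₁, h.isLink₁.left_mem⟩, fun a ha b hb => ?_⟩
  refine h.reach_of_reach hU₁ hU₂ (Set.subset_insert _ _)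
    (fun _ => h.isLink₁.reach (Set.mem_insert _ _)) ha hb (hc.2 _ ?_ _ ?_)
  all_goals rw [h.vertexSet_eq]
  exacts [.inl ⟨a, ha, rfl⟩, .inl ⟨b, hb, rfl⟩]

/-- If `U₂` does not join the ends of the seam, no walk can pass through `G₂`, so nothing has to be
replaced. -/
theorem connects_of_not_reach (h : IsAmalgam G G₁ G₂ d₁ d₂ x₁ y₁ x₂ y₂ φ₁ φ₂ ψ₁ ψ₂)
    (hU₁ : U₁ ⊆ E(G₁) \ {d₁}) (hU₂ : U₂ ⊆ E(G₂) \ {d₂})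
    (hc : G.Connects (ψ₁ '' U₁ ∪ ψ₂ '' U₂)) (hn : ¬ G₂.Reach U₂ x₂ y₂) : G₁.Connects U₁ := by
  refine ⟨⟨x₁, h.isLink₁.left_mem⟩, fun a ha b hb => ?_⟩
  refine h.reach_of_reach hU₁ hU₂ subset_rfl (fun hr => absurd hr hn) ha hb (hc.2 _ ?_ _ ?_)
  all_goals rw [h.vertexSet_eq]
  exacts [.inl ⟨a, ha, rfl⟩, .inl ⟨b, hb, rfl⟩]

/-- The two alternatives are decided by whether `U₂` joins the ends of the seam. -/
theorem connects_iff (h : IsAmalgam G G₁ G₂ d₁ d₂ x₁ y₁ x₂ y₂ φ₁ φ₂ ψ₁ ψ₂)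
    (hU₁ : U₁ ⊆ E(G₁) \ {d₁}) (hU₂ : U₂ ⊆ E(G₂) \ {d₂}) :
    G.Connects (ψ₁ '' U₁ ∪ ψ₂ '' U₂) ↔
      (G₁.Connects U₁ ∧ G₂.Connects (insert d₂ U₂)) ∨
        (G₁.Connects (insert d₁ U₁) ∧ G₂.Connects U₂) := by
  constructor
  · intro hc
    have hc' := hc
    rw [Set.union_comm] at hc'
    have hc₁ := h.connects_insert hU₁ hU₂ hc
    have hc₂ := h.symm.connects_insert hU₂ hU₁ hc'
    by_cases hr : G₂.Reach U₂ x₂ y₂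
    · exact .inr ⟨hc₁, hc₂.of_insert h.isLink₂ subset_rfl hr⟩
    · exact .inl ⟨h.connects_of_not_reach hU₁ hU₂ hc hr, hc₂⟩
  · rintro (hc | hc)
    · exact h.connects_of_connects hU₁ hc.1 hc.2
    · rw [Set.union_comm]
      exact h.symm.connects_of_connects hU₂ hc.2 hc.1

theorem image_union_sdiff₁ (h : IsAmalgam G G₁ G₂ d₁ d₂ x₁ y₁ x₂ y₂ φ₁ φ₂ ψ₁ ψ₂)
    (hU₁ : U₁ ⊆ E(G₁) \ {d₁}) (hU₂ : U₂ ⊆ E(G₂) \ {d₂}) {e : β₁} (he : e ∈ U₁) :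
    (ψ₁ '' U₁ ∪ ψ₂ '' U₂) \ {ψ₁ e} = ψ₁ '' (U₁ \ {e}) ∪ ψ₂ '' U₂ := by
  ext g
  constructor
  · rintro ⟨⟨f, hf, rfl⟩ | ⟨f, hf, rfl⟩, hne⟩
    · exact .inl ⟨f, ⟨hf, fun hfe => hne (congrArg ψ₁ hfe)⟩, rfl⟩
    · exact .inr ⟨f, hf, rfl⟩
  · rintro (⟨f, hf, rfl⟩ | ⟨f, hf, rfl⟩)
    · exact ⟨.inl ⟨f, hf.1, rfl⟩, fun hh => hf.2 (h.injOn_edge₁ (hU₁ hf.1) (hU₁ he) hh)⟩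
    · exact ⟨.inr ⟨f, hf, rfl⟩, fun hh => h.edge_ne e (hU₁ he) f (hU₂ hf) hh.symm⟩

theorem image_union_sdiff₂ (h : IsAmalgam G G₁ G₂ d₁ d₂ x₁ y₁ x₂ y₂ φ₁ φ₂ ψ₁ ψ₂)
    (hU₁ : U₁ ⊆ E(G₁) \ {d₁}) (hU₂ : U₂ ⊆ E(G₂) \ {d₂}) {e : β₂} (he : e ∈ U₂) :
    (ψ₁ '' U₁ ∪ ψ₂ '' U₂) \ {ψ₂ e} = ψ₁ '' U₁ ∪ ψ₂ '' (U₂ \ {e}) := by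
  rw [Set.union_comm, h.symm.image_union_sdiff₁ hU₂ hU₁ he, Set.union_comm]

theorem isMinConnecting_of (h : IsAmalgam G G₁ G₂ d₁ d₂ x₁ y₁ x₂ y₂ φ₁ φ₂ ψ₁ ψ₂)
    (hU₁ : U₁ ⊆ E(G₁) \ {d₁}) (hU₂ : U₂ ⊆ E(G₂) \ {d₂}) (h₁ : G₁.IsMinConnecting U₁)
    (h₂ : G₂.IsMinConnecting (insert d₂ U₂)) : G.IsMinConnecting (ψ₁ '' U₁ ∪ ψ₂ '' U₂) := by
  have hd₂ : d₂ ∉ U₂ := fun hh => (hU₂ hh).2 rfl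
  -- As `d₂` is indispensable, the second alternative of `connects_iff` never applies, and
  -- minimality can be read off from each part separately.
  have hn₂ : ¬ G₂.Connects U₂ := by
    have := h₂.not_connects d₂ (Set.mem_insert _ _)
    rwa [Set.insert_sdiff_self_of_notMem hd₂] at this
  refine ⟨?_, h.connects_of_connects hU₁ h₁.connects h₂.connects, ?_⟩
  · rw [h.edgeSet_eq]
    exact Set.union_subset_union (Set.image_mono hU₁) (Set.image_mono hU₂)
  · rintro e (⟨f, hf, rfl⟩ | ⟨f, hf, rfl⟩)
    · rw [h.image_union_sdiff₁ hU₁ hU₂ hf, h.connects_iff (Set.sdiff_subset.trans hU₁) hU₂]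
      rintro (hc | hc)
      exacts [h₁.not_connects f hf hc.1, hn₂ hc.2]
    · rw [h.image_union_sdiff₂ hU₁ hU₂ hf, h.connects_iff hU₁ (Set.sdiff_subset.trans hU₂)]
      rintro (hc | hc)
      · exact h₂.not_connects f (.inr hf) (hc.2.mono (by grind))
      · exact hn₂ (hc.2.mono Set.sdiff_subset)

theorem isMinConnecting_and (h : IsAmalgam G G₁ G₂ d₁ d₂ x₁ y₁ x₂ y₂ φ₁ φ₂ ψ₁ ψ₂)
    (hU₁ : U₁ ⊆ E(G₁) \ {d₁}) (hU₂ : U₂ ⊆ E(G₂) \ {d₂})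
    (hm : G.IsMinConnecting (ψ₁ '' U₁ ∪ ψ₂ '' U₂)) (hc₁ : G₁.Connects U₁)
    (hc₂ : G₂.Connects (insert d₂ U₂)) :
    G₁.IsMinConnecting U₁ ∧ G₂.IsMinConnecting (insert d₂ U₂) := by
  have hd₂ : d₂ ∉ U₂ := fun hh => (hU₂ hh).2 rfl
  have hm₁ : ∀ f ∈ U₁, ¬ ((G₁.Connects (U₁ \ {f}) ∧ G₂.Connects (insert d₂ U₂)) ∨
      (G₁.Connects (insert d₁ (U₁ \ {f})) ∧ G₂.Connects U₂)) := by
    intro f hf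
    rw [← h.connects_iff (Set.sdiff_subset.trans hU₁) hU₂, ← h.image_union_sdiff₁ hU₁ hU₂ hf]
    exact hm.not_connects _ (.inl ⟨f, hf, rfl⟩)
  have hm₂ : ∀ f ∈ U₂, ¬ ((G₁.Connects U₁ ∧ G₂.Connects (insert d₂ (U₂ \ {f}))) ∨
      (G₁.Connects (insert d₁ U₁) ∧ G₂.Connects (U₂ \ {f}))) := by
    intro f hf
    rw [← h.connects_iff hU₁ (Set.sdiff_subset.trans hU₂), ← h.image_union_sdiff₂ hU₁ hU₂ hf]
    exact hm.not_connects _ (.inr ⟨f, hf, rfl⟩)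
  refine ⟨⟨hU₁.trans Set.sdiff_subset, hc₁, fun f hf hc => hm₁ f hf (.inl ⟨hc, hc₂⟩)⟩,
    ⟨Set.insert_subset h.isLink₂.edge_mem (hU₂.trans Set.sdiff_subset), hc₂, ?_⟩⟩
  rintro f (rfl | hf) hc
  -- If `d₂` were dispensable, `G₂` would carry the seam connection. Then `d₁` could replace some
  -- `g` in `U₁`, and `g` would be superfluous in the glued tree.
  · rw [Set.insert_sdiff_self_of_notMem hd₂] at hc
    obtain ⟨g, hg, hgc⟩ := hc₁.exists_insert_sdiff h.isLink₁ h.ne₁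
    exact hm₁ g hg (.inr ⟨hgc, hc⟩)
  · exact hm₂ f hf (.inl ⟨hc₁, hc.mono (by grind)⟩)

theorem isMinConnecting_iff (h : IsAmalgam G G₁ G₂ d₁ d₂ x₁ y₁ x₂ y₂ φ₁ φ₂ ψ₁ ψ₂)
    (hU₁ : U₁ ⊆ E(G₁) \ {d₁}) (hU₂ : U₂ ⊆ E(G₂) \ {d₂}) :
    G.IsMinConnecting (ψ₁ '' U₁ ∪ ψ₂ '' U₂) ↔
      (G₁.IsMinConnecting U₁ ∧ G₂.IsMinConnecting (insert d₂ U₂)) ∨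
        (G₁.IsMinConnecting (insert d₁ U₁) ∧ G₂.IsMinConnecting U₂) := by
  constructor
  · intro hm
    rcases (h.connects_iff hU₁ hU₂).1 hm.connects with hc | hc
    · exact .inl (h.isMinConnecting_and hU₁ hU₂ hm hc.1 hc.2)
    · rw [Set.union_comm] at hm
      exact .inr (h.symm.isMinConnecting_and hU₂ hU₁ hm hc.2 hc.1).symm
  · rintro (hm | hm)
    · exact h.isMinConnecting_of hU₁ hU₂ hm.1 hm.2
    · rw [Set.union_comm]
      exact h.symm.isMinConnecting_of hU₂ hU₁ hm.2 hm.1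

end IsAmalgam

end Amalgam

end Graph

namespace Graph

/-! ### Tree pairs, exchanges, and gluing of edge sets. -/

section TreePairs

variable {α β α₁ α₂ β₁ β₂ : Type*}

theorem isTreePair_iff {G : Graph α β} {p : Set β × Set β} : G.IsTreePair p ↔
    G.IsMinConnecting p.1 ∧ G.IsMinConnecting p.2 ∧ Disjoint p.1 p.2 ∧ p.1 ∪ p.2 = E(G) := by
  rw [IsTreePair, isSpanningTree_iff, isSpanningTree_iff]

/-- Exchanging `e` in the first and `f` in the second tree gives a pair of trees again. -/
def IsExchange (G : Graph α β) (p : Set β × Set β) (e f : β) : Prop :=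
  e ∈ p.1 ∧ f ∈ p.2 ∧ G.IsTreePair (insert f (p.1 \ {e}), insert e p.2 \ {f})

theorem isUniqueExchange_iff {G : Graph α β} {p : Set β × Set β} {e f : β} :
    G.IsUniqueExchange p.1 p.2 e f ↔ G.IsExchange p e f ∧ ∀ g, G.IsExchange p e g → g = f := by
  unfold IsUniqueExchange IsExchange
  grind

/-- This is symmetric exchange of the two trees. It guarantees that an exchange through the seam can
be continued in the other part. -/
theorem IsTreePair.exists_isExchange {G : Graph α β} {p : Set β × Set β} (hp : G.IsTreePair p)
    {e : β} (he : e ∈ p.1) : ∃ f, G.IsExchange p e f := by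
  obtain ⟨h₁, h₂, hd, hu⟩ := isTreePair_iff.1 hp
  have heT := Set.disjoint_left.1 hd he
  obtain ⟨f, hfT, hfS, hf₁, hf₂⟩ := h₁.exists_exchange h₂ he heT
  have hef : e ≠ f := by grind
  refine ⟨f, he, hfT, isTreePair_iff.2 ⟨hf₁, ?_, ?_, ?_⟩⟩
  · rwa [Set.insert_sdiff_singleton_comm hef] at hf₂
  · rw [Set.disjoint_left] at hd ⊢
    grind
  · simp only
    grind

theorem IsTreePair.ncard_eq {G : Graph α β} (hE : E(G).Finite) {p : Set β × Set β}
    (hp : G.IsTreePair p) {T : Set β} (hT : G.IsMinConnecting T) :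
    p.1.ncard = T.ncard ∧ p.2.ncard = T.ncard := by
  obtain ⟨h₁, h₂, -, -⟩ := isTreePair_iff.1 hp
  exact ⟨h₁.ncard_eq hT (hE.subset h₁.subset_edgeSet), h₂.ncard_eq hT (hE.subset h₂.subset_edgeSet)⟩

/-- The edges of the amalgam that come from `U₁` or `U₂`. -/
def glueSet (d₁ : β₁) (d₂ : β₂) (ψ₁ : β₁ → β) (ψ₂ : β₂ → β) (U₁ : Set β₁) (U₂ : Set β₂) : Set β :=
  ψ₁ '' (U₁ \ {d₁}) ∪ ψ₂ '' (U₂ \ {d₂})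

theorem glueSet_comm (d₁ : β₁) (d₂ : β₂) (ψ₁ : β₁ → β) (ψ₂ : β₂ → β) (U₁ : Set β₁)
    (U₂ : Set β₂) : glueSet d₁ d₂ ψ₁ ψ₂ U₁ U₂ = glueSet d₂ d₁ ψ₂ ψ₁ U₂ U₁ :=
  Set.union_comm _ _

namespace IsAmalgam

variable {G : Graph α β} {G₁ : Graph α₁ β₁} {G₂ : Graph α₂ β₂} {d₁ : β₁} {d₂ : β₂}
    {x₁ y₁ : α₁} {x₂ y₂ : α₂} {φ₁ : α₁ → α} {φ₂ : α₂ → α} {ψ₁ : β₁ → β} {ψ₂ : β₂ → β}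
    {U₁ : Set β₁} {U₂ : Set β₂} {S T : Set β}

theorem mem_glueSet₁ (h : IsAmalgam G G₁ G₂ d₁ d₂ x₁ y₁ x₂ y₂ φ₁ φ₂ ψ₁ ψ₂)
    (hU₁ : U₁ ⊆ E(G₁)) (hU₂ : U₂ ⊆ E(G₂)) {e : β₁} (he : e ∈ E(G₁) \ {d₁}) :
    ψ₁ e ∈ glueSet d₁ d₂ ψ₁ ψ₂ U₁ U₂ ↔ e ∈ U₁ := by
  constructor
  · rintro (⟨f, hf, hfe⟩ | ⟨f, hf, hfe⟩)
    · rw [← h.injOn_edge₁ ⟨hU₁ hf.1, hf.2⟩ he hfe]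
      exact hf.1
    · exact absurd hfe.symm (h.edge_ne e he f ⟨hU₂ hf.1, hf.2⟩)
  · exact fun heU => .inl ⟨e, ⟨heU, he.2⟩, rfl⟩

theorem mem_glueSet₂ (h : IsAmalgam G G₁ G₂ d₁ d₂ x₁ y₁ x₂ y₂ φ₁ φ₂ ψ₁ ψ₂)
    (hU₁ : U₁ ⊆ E(G₁)) (hU₂ : U₂ ⊆ E(G₂)) {e : β₂} (he : e ∈ E(G₂) \ {d₂}) :
    ψ₂ e ∈ glueSet d₁ d₂ ψ₁ ψ₂ U₁ U₂ ↔ e ∈ U₂ := by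
  rw [glueSet_comm, h.symm.mem_glueSet₁ hU₂ hU₁ he]

theorem map_mem₁ (h : IsAmalgam G G₁ G₂ d₁ d₂ x₁ y₁ x₂ y₂ φ₁ φ₂ ψ₁ ψ₂)
    {e : β₁} (he : e ∈ E(G₁) \ {d₁}) : ψ₁ e ∈ E(G) := by
  rw [h.edgeSet_eq]
  exact .inl ⟨e, he, rfl⟩

theorem glueSet_subset (h : IsAmalgam G G₁ G₂ d₁ d₂ x₁ y₁ x₂ y₂ φ₁ φ₂ ψ₁ ψ₂)
    (hU₁ : U₁ ⊆ E(G₁)) (hU₂ : U₂ ⊆ E(G₂)) : glueSet d₁ d₂ ψ₁ ψ₂ U₁ U₂ ⊆ E(G) := by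
  rw [h.edgeSet_eq]
  exact Set.union_subset_union (Set.image_mono (Set.sdiff_subset_sdiff_left hU₁))
    (Set.image_mono (Set.sdiff_subset_sdiff_left hU₂))

/-- Reduces the identities between glued sets below to membership tests in each part. -/
theorem edge_ext (h : IsAmalgam G G₁ G₂ d₁ d₂ x₁ y₁ x₂ y₂ φ₁ φ₂ ψ₁ ψ₂) (hS : S ⊆ E(G))
    (hT : T ⊆ E(G)) (h₁ : ∀ e ∈ E(G₁) \ {d₁}, ψ₁ e ∈ S ↔ ψ₁ e ∈ T)
    (h₂ : ∀ e ∈ E(G₂) \ {d₂}, ψ₂ e ∈ S ↔ ψ₂ e ∈ T) : S = T := by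
  ext g
  by_cases hg : g ∈ E(G)
  · obtain ⟨e, he, rfl⟩ | ⟨e, he, rfl⟩ := h.exists_of_mem g hg
    exacts [h₁ e he, h₂ e he]
  · exact ⟨fun k => absurd (hS k) hg, fun k => absurd (hT k) hg⟩

theorem insert_glueSet_sdiff₁ (h : IsAmalgam G G₁ G₂ d₁ d₂ x₁ y₁ x₂ y₂ φ₁ φ₂ ψ₁ ψ₂)
    (hU₁ : U₁ ⊆ E(G₁)) (hU₂ : U₂ ⊆ E(G₂)) {e f : β₁} (he : e ∈ E(G₁) \ {d₁})
    (hf : f ∈ E(G₁) \ {d₁}) :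
    insert (ψ₁ f) (glueSet d₁ d₂ ψ₁ ψ₂ U₁ U₂ \ {ψ₁ e}) =
      glueSet d₁ d₂ ψ₁ ψ₂ (insert f (U₁ \ {e})) U₂ := by
  have hU₁' : insert f (U₁ \ {e}) ⊆ E(G₁) := Set.insert_subset hf.1 (Set.sdiff_subset.trans hU₁)
  refine h.edge_ext (Set.insert_subset (h.map_mem₁ hf)
    (Set.sdiff_subset.trans (h.glueSet_subset hU₁ hU₂))) (h.glueSet_subset hU₁' hU₂) ?_ ?_
  · intro g hg
    rw [h.mem_glueSet₁ hU₁' hU₂ hg, Set.mem_insert_iff, Set.mem_sdiff, h.mem_glueSet₁ hU₁ hU₂ hg,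
      Set.mem_singleton_iff, h.injOn_edge₁.eq_iff hg hf, h.injOn_edge₁.eq_iff hg he]
    rfl
  · intro g hg
    rw [h.mem_glueSet₂ hU₁' hU₂ hg, Set.mem_insert_iff, Set.mem_sdiff, h.mem_glueSet₂ hU₁ hU₂ hg]
    have := h.edge_ne f hf g hg
    have := h.edge_ne e he g hg
    grind

theorem insert_glueSet_sdiff₁' (h : IsAmalgam G G₁ G₂ d₁ d₂ x₁ y₁ x₂ y₂ φ₁ φ₂ ψ₁ ψ₂)
    (hU₁ : U₁ ⊆ E(G₁)) (hU₂ : U₂ ⊆ E(G₂)) {e f : β₁} (he : e ∈ E(G₁) \ {d₁})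
    (hf : f ∈ E(G₁) \ {d₁}) :
    insert (ψ₁ e) (glueSet d₁ d₂ ψ₁ ψ₂ U₁ U₂) \ {ψ₁ f} =
      glueSet d₁ d₂ ψ₁ ψ₂ (insert e U₁ \ {f}) U₂ := by
  have hU₁' : insert e U₁ \ {f} ⊆ E(G₁) := Set.sdiff_subset.trans (Set.insert_subset he.1 hU₁)
  refine h.edge_ext (Set.sdiff_subset.trans (Set.insert_subset (h.map_mem₁ he)
    (h.glueSet_subset hU₁ hU₂))) (h.glueSet_subset hU₁' hU₂) ?_ ?_
  · intro g hg
    rw [h.mem_glueSet₁ hU₁' hU₂ hg, Set.mem_sdiff, Set.mem_insert_iff, h.mem_glueSet₁ hU₁ hU₂ hg,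
      Set.mem_singleton_iff, h.injOn_edge₁.eq_iff hg hf, h.injOn_edge₁.eq_iff hg he]
    rfl
  · intro g hg
    rw [h.mem_glueSet₂ hU₁' hU₂ hg, Set.mem_sdiff, Set.mem_insert_iff, h.mem_glueSet₂ hU₁ hU₂ hg]
    have := h.edge_ne f hf g hg
    have := h.edge_ne e he g hg
    grind

/-- Gluing forgets the seam edges. So an exchange across the parts may be written as `d₁` for `e` in
`G₁` and `f` for `d₂` in `G₂`, which are exchanges within the parts. -/
theorem insert_glueSet_sdiff₂ (h : IsAmalgam G G₁ G₂ d₁ d₂ x₁ y₁ x₂ y₂ φ₁ φ₂ ψ₁ ψ₂)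
    (hU₁ : U₁ ⊆ E(G₁)) (hU₂ : U₂ ⊆ E(G₂)) {e : β₁} {f : β₂} (he : e ∈ E(G₁) \ {d₁})
    (hf : f ∈ E(G₂) \ {d₂}) :
    insert (ψ₂ f) (glueSet d₁ d₂ ψ₁ ψ₂ U₁ U₂ \ {ψ₁ e}) =
      glueSet d₁ d₂ ψ₁ ψ₂ (insert d₁ (U₁ \ {e})) (insert f (U₂ \ {d₂})) := by
  have hU₁' : insert d₁ (U₁ \ {e}) ⊆ E(G₁) :=
    Set.insert_subset h.isLink₁.edge_mem (Set.sdiff_subset.trans hU₁)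
  have hU₂' : insert f (U₂ \ {d₂}) ⊆ E(G₂) :=
    Set.insert_subset hf.1 (Set.sdiff_subset.trans hU₂)
  refine h.edge_ext (Set.insert_subset (h.symm.map_mem₁ hf)
    (Set.sdiff_subset.trans (h.glueSet_subset hU₁ hU₂))) (h.glueSet_subset hU₁' hU₂') ?_ ?_
  · intro g hg
    rw [h.mem_glueSet₁ hU₁' hU₂' hg, Set.mem_insert_iff, Set.mem_sdiff, h.mem_glueSet₁ hU₁ hU₂ hg,
      Set.mem_singleton_iff, h.injOn_edge₁.eq_iff hg he]
    have := h.edge_ne g hg f hf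
    grind
  · intro g hg
    rw [h.mem_glueSet₂ hU₁' hU₂' hg, Set.mem_insert_iff, Set.mem_sdiff, h.mem_glueSet₂ hU₁ hU₂ hg,
      h.injOn_edge₂.eq_iff hg hf]
    have := h.edge_ne e he g hg
    grind

theorem insert_glueSet_sdiff₂' (h : IsAmalgam G G₁ G₂ d₁ d₂ x₁ y₁ x₂ y₂ φ₁ φ₂ ψ₁ ψ₂)
    (hU₁ : U₁ ⊆ E(G₁)) (hU₂ : U₂ ⊆ E(G₂)) {e : β₁} {f : β₂} (he : e ∈ E(G₁) \ {d₁})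
    (hf : f ∈ E(G₂) \ {d₂}) :
    insert (ψ₁ e) (glueSet d₁ d₂ ψ₁ ψ₂ U₁ U₂) \ {ψ₂ f} =
      glueSet d₁ d₂ ψ₁ ψ₂ (insert e U₁ \ {d₁}) (insert d₂ U₂ \ {f}) := by
  have hU₁' : insert e U₁ \ {d₁} ⊆ E(G₁) := Set.sdiff_subset.trans (Set.insert_subset he.1 hU₁)
  have hU₂' : insert d₂ U₂ \ {f} ⊆ E(G₂) :=
    Set.sdiff_subset.trans (Set.insert_subset h.isLink₂.edge_mem hU₂)
  refine h.edge_ext (Set.sdiff_subset.trans (Set.insert_subset (h.map_mem₁ he)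
    (h.glueSet_subset hU₁ hU₂))) (h.glueSet_subset hU₁' hU₂') ?_ ?_
  · intro g hg
    rw [h.mem_glueSet₁ hU₁' hU₂' hg, Set.mem_sdiff, Set.mem_insert_iff, h.mem_glueSet₁ hU₁ hU₂ hg,
      h.injOn_edge₁.eq_iff hg he]
    have := h.edge_ne g hg f hf
    grind
  · intro g hg
    rw [h.mem_glueSet₂ hU₁' hU₂' hg, Set.mem_sdiff, Set.mem_insert_iff, h.mem_glueSet₂ hU₁ hU₂ hg,
      Set.mem_singleton_iff, h.injOn_edge₂.eq_iff hg hf]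
    have := h.edge_ne e he g hg
    grind

theorem isMinConnecting_glueSet (h : IsAmalgam G G₁ G₂ d₁ d₂ x₁ y₁ x₂ y₂ φ₁ φ₂ ψ₁ ψ₂)
    (hU₁ : U₁ ⊆ E(G₁)) (hU₂ : U₂ ⊆ E(G₂)) :
    G.IsMinConnecting (glueSet d₁ d₂ ψ₁ ψ₂ U₁ U₂) ↔
      (G₁.IsMinConnecting (U₁ \ {d₁}) ∧ G₂.IsMinConnecting (insert d₂ U₂)) ∨
        (G₁.IsMinConnecting (insert d₁ U₁) ∧ G₂.IsMinConnecting (U₂ \ {d₂})) := by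
  rw [glueSet, h.isMinConnecting_iff (Set.sdiff_subset_sdiff_left hU₁)
    (Set.sdiff_subset_sdiff_left hU₂), Set.insert_sdiff_singleton, Set.insert_sdiff_singleton]

/-- The partition of the edges of the amalgam induced by partitions of the edges of its parts. -/
theorem glueSet_disjoint_union (h : IsAmalgam G G₁ G₂ d₁ d₂ x₁ y₁ x₂ y₂ φ₁ φ₂ ψ₁ ψ₂)
    {p₁ : Set β₁ × Set β₁} {p₂ : Set β₂ × Set β₂} (hd₁ : Disjoint p₁.1 p₁.2)
    (hu₁ : p₁.1 ∪ p₁.2 = E(G₁)) (hd₂ : Disjoint p₂.1 p₂.2) (hu₂ : p₂.1 ∪ p₂.2 = E(G₂)) :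
    Disjoint (glueSet d₁ d₂ ψ₁ ψ₂ p₁.1 p₂.1) (glueSet d₁ d₂ ψ₁ ψ₂ p₁.2 p₂.2) ∧
      glueSet d₁ d₂ ψ₁ ψ₂ p₁.1 p₂.1 ∪ glueSet d₁ d₂ ψ₁ ψ₂ p₁.2 p₂.2 = E(G) := by
  have h11 : p₁.1 ⊆ E(G₁) := hu₁ ▸ Set.subset_union_left
  have h12 : p₁.2 ⊆ E(G₁) := hu₁ ▸ Set.subset_union_right
  have h21 : p₂.1 ⊆ E(G₂) := hu₂ ▸ Set.subset_union_left
  have h22 : p₂.2 ⊆ E(G₂) := hu₂ ▸ Set.subset_union_right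
  have hs₁ := h.glueSet_subset h11 h21
  have hs₂ := h.glueSet_subset h12 h22
  rw [Set.disjoint_left] at hd₁ hd₂
  constructor
  · rw [Set.disjoint_left]
    intro g hg hg'
    obtain ⟨e, he, rfl⟩ | ⟨e, he, rfl⟩ := h.exists_of_mem g (hs₁ hg)
    · exact hd₁ ((h.mem_glueSet₁ h11 h21 he).1 hg) ((h.mem_glueSet₁ h12 h22 he).1 hg')
    · exact hd₂ ((h.mem_glueSet₂ h11 h21 he).1 hg) ((h.mem_glueSet₂ h12 h22 he).1 hg')
  · refine h.edge_ext (Set.union_subset hs₁ hs₂) subset_rfl ?_ ?_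
    · intro e he
      rw [Set.mem_union, h.mem_glueSet₁ h11 h21 he, h.mem_glueSet₁ h12 h22 he, ← Set.mem_union, hu₁]
      exact ⟨fun _ => h.map_mem₁ he, fun _ => he.1⟩
    · intro e he
      rw [Set.mem_union, h.mem_glueSet₂ h11 h21 he, h.mem_glueSet₂ h12 h22 he, ← Set.mem_union, hu₂]
      exact ⟨fun _ => h.symm.map_mem₁ he, fun _ => he.1⟩

end IsAmalgam

end TreePairs

end Graph

namespace Graph

/-! ### Tree pairs of the glued graph and seam-split pairs of tree pairs. -/

section Exchanges

variable {α β α₁ α₂ β₁ β₂ : Type*}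

theorem ncard_insert_sdiff_singleton {A : Set β} (hA : A.Finite) {e f : β} (he : e ∈ A)
    (hf : f ∉ A) : (insert f (A \ {e})).ncard = A.ncard := by
  rw [Set.ncard_insert_of_notMem (fun h => hf h.1) hA.sdiff,
    Set.ncard_sdiff_singleton_add_one he hA]

/-- The pair of edge sets of the amalgam induced by pairs for its two parts. -/
def gluePair (d₁ : β₁) (d₂ : β₂) (ψ₁ : β₁ → β) (ψ₂ : β₂ → β) (p₁ : Set β₁ × Set β₁)
    (p₂ : Set β₂ × Set β₂) : Set β × Set β :=
  (glueSet d₁ d₂ ψ₁ ψ₂ p₁.1 p₂.1, glueSet d₁ d₂ ψ₁ ψ₂ p₁.2 p₂.2)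

theorem gluePair_comm (d₁ : β₁) (d₂ : β₂) (ψ₁ : β₁ → β) (ψ₂ : β₂ → β) (p₁ : Set β₁ × Set β₁)
    (p₂ : Set β₂ × Set β₂) : gluePair d₁ d₂ ψ₁ ψ₂ p₁ p₂ = gluePair d₂ d₁ ψ₂ ψ₁ p₂ p₁ := by
  rw [gluePair, gluePair, glueSet_comm, glueSet_comm _ _ _ _ p₁.2]

theorem SeamSplit.symm {d₁ : β₁} {d₂ : β₂} {p₁ : Set β₁ × Set β₁} {p₂ : Set β₂ × Set β₂}
    (h : SeamSplit d₁ d₂ p₁ p₂) : SeamSplit d₂ d₁ p₂ p₁ := by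
  unfold SeamSplit at *
  tauto

theorem SeamSplit.swap {d₁ : β₁} {d₂ : β₂} {p₁ : Set β₁ × Set β₁} {p₂ : Set β₂ × Set β₂}
    (h : SeamSplit d₁ d₂ p₁ p₂) : SeamSplit d₁ d₂ p₁.swap p₂.swap := by
  unfold SeamSplit at *
  simp only [Prod.fst_swap, Prod.snd_swap]
  tauto

namespace IsAmalgam

variable {G : Graph α β} {G₁ : Graph α₁ β₁} {G₂ : Graph α₂ β₂} {d₁ : β₁} {d₂ : β₂}
    {x₁ y₁ : α₁} {x₂ y₂ : α₂} {φ₁ : α₁ → α} {φ₂ : α₂ → α} {ψ₁ : β₁ → β} {ψ₂ : β₂ → β}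
    {p₁ q₁ : Set β₁ × Set β₁} {p₂ q₂ : Set β₂ × Set β₂}

/-- The position of the seam edges in a seam-split pair of partitions. -/
theorem seam_cases (h : IsAmalgam G G₁ G₂ d₁ d₂ x₁ y₁ x₂ y₂ φ₁ φ₂ ψ₁ ψ₂)
    (hu₁ : p₁.1 ∪ p₁.2 = E(G₁)) (hu₂ : p₂.1 ∪ p₂.2 = E(G₂)) (hs : SeamSplit d₁ d₂ p₁ p₂) :
    (d₁ ∈ p₁.1 ∧ d₁ ∉ p₁.2 ∧ d₂ ∉ p₂.1 ∧ d₂ ∈ p₂.2) ∨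
      (d₁ ∉ p₁.1 ∧ d₁ ∈ p₁.2 ∧ d₂ ∈ p₂.1 ∧ d₂ ∉ p₂.2) := by
  have h₁ : d₁ ∈ p₁.1 ∪ p₁.2 := hu₁ ▸ h.isLink₁.edge_mem
  have h₂ : d₂ ∈ p₂.1 ∪ p₂.2 := hu₂ ▸ h.isLink₂.edge_mem
  unfold SeamSplit at hs
  grind

theorem isTreePair_gluePair (h : IsAmalgam G G₁ G₂ d₁ d₂ x₁ y₁ x₂ y₂ φ₁ φ₂ ψ₁ ψ₂)
    (hp₁ : G₁.IsTreePair p₁) (hp₂ : G₂.IsTreePair p₂) (hs : SeamSplit d₁ d₂ p₁ p₂) :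
    G.IsTreePair (gluePair d₁ d₂ ψ₁ ψ₂ p₁ p₂) := by
  obtain ⟨h11, h12, hd₁, hu₁⟩ := isTreePair_iff.1 hp₁
  obtain ⟨h21, h22, hd₂, hu₂⟩ := isTreePair_iff.1 hp₂
  have key := h.glueSet_disjoint_union hd₁ hu₁ hd₂ hu₂
  refine isTreePair_iff.2 ⟨?_, ?_, key.1, key.2⟩
  · refine (h.isMinConnecting_glueSet h11.subset_edgeSet h21.subset_edgeSet).2 ?_
    rcases h.seam_cases hu₁ hu₂ hs with ⟨k1, k2, k3, k4⟩ | ⟨k1, k2, k3, k4⟩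
    · right
      rw [Set.insert_eq_of_mem k1, Set.sdiff_singleton_eq_self k3]
      exact ⟨h11, h21⟩
    · left
      rw [Set.insert_eq_of_mem k3, Set.sdiff_singleton_eq_self k1]
      exact ⟨h11, h21⟩
  · refine (h.isMinConnecting_glueSet h12.subset_edgeSet h22.subset_edgeSet).2 ?_
    rcases h.seam_cases hu₁ hu₂ hs with ⟨k1, k2, k3, k4⟩ | ⟨k1, k2, k3, k4⟩
    · left
      rw [Set.insert_eq_of_mem k4, Set.sdiff_singleton_eq_self k2]
      exact ⟨h12, h22⟩
    · right
      rw [Set.insert_eq_of_mem k2, Set.sdiff_singleton_eq_self k4]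
      exact ⟨h12, h22⟩

theorem finite_edgeSet₁ (h : IsAmalgam G G₁ G₂ d₁ d₂ x₁ y₁ x₂ y₂ φ₁ φ₂ ψ₁ ψ₂)
    (hE : E(G).Finite) : E(G₁).Finite := by
  refine Set.Finite.of_sdiff (t := {d₁}) (Set.Finite.of_finite_image ?_ h.injOn_edge₁)
    (Set.finite_singleton d₁)
  refine hE.subset ?_
  rw [h.edgeSet_eq]
  exact Set.subset_union_left

/-- The characterization of glued trees leaves two alternatives. The wrong one would give a spanning
tree of `G₁` with one edge more or fewer than `U₁`. -/
theorem isMinConnecting_of_ncard_eq (h : IsAmalgam G G₁ G₂ d₁ d₂ x₁ y₁ x₂ y₂ φ₁ φ₂ ψ₁ ψ₂)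
    (hE : E(G).Finite) {U₁ : Set β₁} {U₂ : Set β₂} (hU₁ : U₁ ⊆ E(G₁)) (hU₂ : U₂ ⊆ E(G₂))
    (hs : (d₁ ∈ U₁ ∧ d₂ ∉ U₂) ∨ (d₁ ∉ U₁ ∧ d₂ ∈ U₂))
    (hn : ∀ T, G₁.IsMinConnecting T → U₁.ncard = T.ncard)
    (hm : G.IsMinConnecting (glueSet d₁ d₂ ψ₁ ψ₂ U₁ U₂)) :
    G₁.IsMinConnecting U₁ ∧ G₂.IsMinConnecting U₂ := by
  have hfin := (h.finite_edgeSet₁ hE).subset hU₁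
  rw [h.isMinConnecting_glueSet hU₁ hU₂] at hm
  rcases hs with ⟨k1, k2⟩ | ⟨k1, k2⟩
  · rcases hm with hm | hm
    · have := hn _ hm.1
      have := Set.ncard_sdiff_singleton_add_one k1 hfin
      omega
    · rwa [Set.insert_eq_of_mem k1, Set.sdiff_singleton_eq_self k2] at hm
  · rcases hm with hm | hm
    · rwa [Set.insert_eq_of_mem k2, Set.sdiff_singleton_eq_self k1] at hm
    · have := hn _ hm.1
      have := Set.ncard_insert_of_notMem k1 hfin
      omega

theorem isTreePair_of_gluePair (h : IsAmalgam G G₁ G₂ d₁ d₂ x₁ y₁ x₂ y₂ φ₁ φ₂ ψ₁ ψ₂)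
    (hE : E(G).Finite) (hd₁ : Disjoint p₁.1 p₁.2) (hu₁ : p₁.1 ∪ p₁.2 = E(G₁))
    (hd₂ : Disjoint p₂.1 p₂.2) (hu₂ : p₂.1 ∪ p₂.2 = E(G₂)) (hs : SeamSplit d₁ d₂ p₁ p₂)
    (hn : ∀ T, G₁.IsMinConnecting T → p₁.1.ncard = T.ncard ∧ p₁.2.ncard = T.ncard)
    (hm : G.IsTreePair (gluePair d₁ d₂ ψ₁ ψ₂ p₁ p₂)) : G₁.IsTreePair p₁ ∧ G₂.IsTreePair p₂ := by
  obtain ⟨hm₁, hm₂, -, -⟩ := isTreePair_iff.1 hm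
  have hc := h.seam_cases hu₁ hu₂ hs
  have k₁ := h.isMinConnecting_of_ncard_eq hE (hu₁ ▸ Set.subset_union_left)
    (hu₂ ▸ Set.subset_union_left) (by tauto) (fun T hT => (hn T hT).1) hm₁
  have k₂ := h.isMinConnecting_of_ncard_eq hE (hu₁ ▸ Set.subset_union_right)
    (hu₂ ▸ Set.subset_union_right) (by tauto) (fun T hT => (hn T hT).2) hm₂
  exact ⟨isTreePair_iff.2 ⟨k₁.1, k₂.1, hd₁, hu₁⟩, isTreePair_iff.2 ⟨k₁.2, k₂.2, hd₂, hu₂⟩⟩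

theorem exists_glueSet_eq (h : IsAmalgam G G₁ G₂ d₁ d₂ x₁ y₁ x₂ y₂ φ₁ φ₂ ψ₁ ψ₂) {S : Set β}
    (hS : S ⊆ E(G)) : ∃ U₁ ⊆ E(G₁) \ {d₁}, ∃ U₂ ⊆ E(G₂) \ {d₂},
      S = ψ₁ '' U₁ ∪ ψ₂ '' U₂ := by
  refine ⟨{e | e ∈ E(G₁) \ {d₁} ∧ ψ₁ e ∈ S}, fun e he => he.1,
    {e | e ∈ E(G₂) \ {d₂} ∧ ψ₂ e ∈ S}, fun e he => he.1, ?_⟩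
  ext g
  constructor
  · intro hg
    obtain ⟨e, he, rfl⟩ | ⟨e, he, rfl⟩ := h.exists_of_mem g (hS hg)
    exacts [.inl ⟨e, ⟨he, hg⟩, rfl⟩, .inr ⟨e, ⟨he, hg⟩, rfl⟩]
  · rintro (⟨e, he, rfl⟩ | ⟨e, he, rfl⟩)
    exacts [he.2, he.2]

theorem partition_of_image (h : IsAmalgam G G₁ G₂ d₁ d₂ x₁ y₁ x₂ y₂ φ₁ φ₂ ψ₁ ψ₂)
    {S₁ T₁ : Set β₁} {S₂ T₂ : Set β₂} (hS₁ : S₁ ⊆ E(G₁) \ {d₁}) (hT₁ : T₁ ⊆ E(G₁) \ {d₁})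
    (hS₂ : S₂ ⊆ E(G₂) \ {d₂}) (hT₂ : T₂ ⊆ E(G₂) \ {d₂})
    (hd : Disjoint (ψ₁ '' S₁ ∪ ψ₂ '' S₂) (ψ₁ '' T₁ ∪ ψ₂ '' T₂))
    (hu : (ψ₁ '' S₁ ∪ ψ₂ '' S₂) ∪ (ψ₁ '' T₁ ∪ ψ₂ '' T₂) = E(G)) :
    Disjoint S₁ T₁ ∧ S₁ ∪ T₁ = E(G₁) \ {d₁} := by
  constructor
  · rw [Set.disjoint_left] at hd ⊢
    exact fun e he he' => hd (.inl ⟨e, he, rfl⟩) (.inl ⟨e, he', rfl⟩)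
  · refine (Set.union_subset hS₁ hT₁).antisymm fun e he => ?_
    have := h.map_mem₁ he
    rw [← hu] at this
    rcases this with (⟨f, hf, hfe⟩ | ⟨f, hf, hfe⟩) | (⟨f, hf, hfe⟩ | ⟨f, hf, hfe⟩)
    · exact .inl (h.injOn_edge₁ (hS₁ hf) he hfe ▸ hf)
    · exact absurd hfe.symm (h.edge_ne e he f (hS₂ hf))
    · exact .inr (h.injOn_edge₁ (hT₁ hf) he hfe ▸ hf)
    · exact absurd hfe.symm (h.edge_ne e he f (hT₂ hf))

end IsAmalgam

/-- The edges of a finite bispanning graph except one are not the disjoint union of two trees. -/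
theorem IsBispanning.not_partition {G : Graph α β} (hG : G.IsBispanning) (hE : E(G).Finite)
    {d : β} (hd : d ∈ E(G)) {S T : Set β} (hS : G.IsMinConnecting S) (hT : G.IsMinConnecting T)
    (hdis : Disjoint S T) : S ∪ T ≠ E(G) \ {d} := by
  intro hu
  obtain ⟨p, hp⟩ := hG
  have h₁ := (hp.ncard_eq hE hS).1
  have h₂ := (hp.ncard_eq hE hT).2
  obtain ⟨k₁, k₂, k₃, k₄⟩ := isTreePair_iff.1 hp
  have e₁ := Set.ncard_union_eq hdis (hE.subset hS.subset_edgeSet) (hE.subset hT.subset_edgeSet)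
  have e₂ := Set.ncard_union_eq k₃ (hE.subset k₁.subset_edgeSet) (hE.subset k₂.subset_edgeSet)
  have e₃ := Set.ncard_sdiff_singleton_add_one hd hE
  rw [hu] at e₁
  rw [k₄] at e₂
  omega

namespace IsAmalgam

variable {G : Graph α β} {G₁ : Graph α₁ β₁} {G₂ : Graph α₂ β₂} {d₁ : β₁} {d₂ : β₂}
    {x₁ y₁ : α₁} {x₂ y₂ : α₂} {φ₁ : α₁ → α} {φ₂ : α₂ → α} {ψ₁ : β₁ → β} {ψ₂ : β₂ → β}
    {p₁ q₁ : Set β₁ × Set β₁} {p₂ q₂ : Set β₂ × Set β₂}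

theorem isTreePair_insert (h : IsAmalgam G G₁ G₂ d₁ d₂ x₁ y₁ x₂ y₂ φ₁ φ₂ ψ₁ ψ₂)
    {S T : Set β₁} (hd : Disjoint S T) (hu : S ∪ T = E(G₁) \ {d₁}) (hS : G₁.IsMinConnecting S)
    (hT : G₁.IsMinConnecting (insert d₁ T)) : G₁.IsTreePair (S, insert d₁ T) := by
  have hdS : d₁ ∉ S := fun hh => (hu.subset (.inl hh)).2 rfl
  refine isTreePair_iff.2 ⟨hS, hT, Set.disjoint_insert_right.2 ⟨hdS, hd⟩, ?_⟩
  rw [Set.union_insert, hu, Set.insert_sdiff_singleton, Set.insert_eq_of_mem h.isLink₁.edge_mem]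

theorem exists_gluePair_eq_image (h : IsAmalgam G G₁ G₂ d₁ d₂ x₁ y₁ x₂ y₂ φ₁ φ₂ ψ₁ ψ₂)
    {S₁ T₁ : Set β₁} {S₂ T₂ : Set β₂}
    (hd₁ : Disjoint S₁ T₁) (hu₁ : S₁ ∪ T₁ = E(G₁) \ {d₁})
    (hd₂ : Disjoint S₂ T₂) (hu₂ : S₂ ∪ T₂ = E(G₂) \ {d₂})
    (hS₁ : G₁.IsMinConnecting S₁) (hT₁ : G₁.IsMinConnecting (insert d₁ T₁))
    (hS₂ : G₂.IsMinConnecting (insert d₂ S₂)) (hT₂ : G₂.IsMinConnecting T₂) :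
    ∃ p₁ p₂, G₁.IsTreePair p₁ ∧ G₂.IsTreePair p₂ ∧ SeamSplit d₁ d₂ p₁ p₂ ∧
      gluePair d₁ d₂ ψ₁ ψ₂ p₁ p₂ = (ψ₁ '' S₁ ∪ ψ₂ '' S₂, ψ₁ '' T₁ ∪ ψ₂ '' T₂) := by
  have k1 : d₁ ∉ S₁ := fun hh => (hu₁.subset (.inl hh)).2 rfl
  have k2 : d₁ ∉ T₁ := fun hh => (hu₁.subset (.inr hh)).2 rfl
  have k3 : d₂ ∉ S₂ := fun hh => (hu₂.subset (.inl hh)).2 rfl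
  have k4 : d₂ ∉ T₂ := fun hh => (hu₂.subset (.inr hh)).2 rfl
  refine ⟨(S₁, insert d₁ T₁), (insert d₂ S₂, T₂), h.isTreePair_insert hd₁ hu₁ hS₁ hT₁,
    (h.symm.isTreePair_insert hd₂.symm ((Set.union_comm _ _).trans hu₂) hT₂ hS₂).swap, ?_, ?_⟩
  · simp [SeamSplit, k1, k4]
  · simp [gluePair, glueSet, k1, k2, k3, k4]

/-- If both trees made the same choice at the seam, the edges of one part other than its seam edge
would split into two spanning trees. That is one edge too few. So the choices are opposite, and
adding each seam edge to the trace that needs it gives the two tree pairs. -/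
theorem exists_of_isTreePair (h : IsAmalgam G G₁ G₂ d₁ d₂ x₁ y₁ x₂ y₂ φ₁ φ₂ ψ₁ ψ₂)
    (hE : E(G).Finite) (h₁ : G₁.IsBispanning) (h₂ : G₂.IsBispanning) {p : Set β × Set β}
    (hp : G.IsTreePair p) : ∃ p₁ p₂, G₁.IsTreePair p₁ ∧ G₂.IsTreePair p₂ ∧
      SeamSplit d₁ d₂ p₁ p₂ ∧ gluePair d₁ d₂ ψ₁ ψ₂ p₁ p₂ = p := by
  obtain ⟨S, T⟩ := p
  obtain ⟨hS, hT, hd, hu⟩ := isTreePair_iff.1 hp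
  simp only at hS hT hd hu
  obtain ⟨S₁, hS₁, S₂, hS₂, rfl⟩ := h.exists_glueSet_eq hS.subset_edgeSet
  obtain ⟨T₁, hT₁, T₂, hT₂, rfl⟩ := h.exists_glueSet_eq hT.subset_edgeSet
  obtain ⟨hd₁, hu₁⟩ := h.partition_of_image hS₁ hT₁ hS₂ hT₂ hd hu
  obtain ⟨hd₂, hu₂⟩ := h.symm.partition_of_image hS₂ hT₂ hS₁ hT₁
    (by rwa [Set.union_comm, Set.union_comm (ψ₂ '' T₂)])
    (by rwa [Set.union_comm (ψ₂ '' S₂), Set.union_comm (ψ₂ '' T₂)])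
  rw [h.isMinConnecting_iff hS₁ hS₂] at hS
  rw [h.isMinConnecting_iff hT₁ hT₂] at hT
  rcases hS with hS | hS <;> rcases hT with hT | hT
  · exact absurd hu₁
      (h₁.not_partition (h.finite_edgeSet₁ hE) h.isLink₁.edge_mem hS.1 hT.1 hd₁)
  · exact h.exists_gluePair_eq_image hd₁ hu₁ hd₂ hu₂ hS.1 hT.1 hS.2 hT.2
  · obtain ⟨p₁, p₂, hp₁, hp₂, hs, hg⟩ := h.exists_gluePair_eq_image hd₁.symm
      ((Set.union_comm _ _).trans hu₁) hd₂.symm ((Set.union_comm _ _).trans hu₂)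
      hT.1 hS.1 hT.2 hS.2
    exact ⟨p₁.swap, p₂.swap, hp₁.swap, hp₂.swap, hs.swap, congrArg Prod.swap hg⟩
  · exact absurd hu₂
      (h₂.not_partition (h.symm.finite_edgeSet₁ hE) h.isLink₂.edge_mem hS.2 hT.2 hd₂)

/-- The glued set determines each trace up to the seam edge, and two spanning trees cannot differ by
a single edge, since one would contain the other. -/
theorem eq_of_glueSet_eq (h : IsAmalgam G G₁ G₂ d₁ d₂ x₁ y₁ x₂ y₂ φ₁ φ₂ ψ₁ ψ₂)
    {U₁ W₁ : Set β₁} {U₂ W₂ : Set β₂} (hU₁ : G₁.IsMinConnecting U₁)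
    (hW₁ : G₁.IsMinConnecting W₁) (hU₂ : U₂ ⊆ E(G₂)) (hW₂ : W₂ ⊆ E(G₂))
    (hg : glueSet d₁ d₂ ψ₁ ψ₂ U₁ U₂ = glueSet d₁ d₂ ψ₁ ψ₂ W₁ W₂) : U₁ = W₁ := by
  have hm : ∀ e ≠ d₁, e ∈ U₁ ↔ e ∈ W₁ := by
    intro e he
    by_cases heE : e ∈ E(G₁)
    · rw [← h.mem_glueSet₁ hU₁.subset_edgeSet hU₂ ⟨heE, he⟩, hg,
        h.mem_glueSet₁ hW₁.subset_edgeSet hW₂ ⟨heE, he⟩]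
    · exact ⟨fun k => absurd (hU₁.subset_edgeSet k) heE,
        fun k => absurd (hW₁.subset_edgeSet k) heE⟩
  have key : ∀ {A B : Set β₁}, G₁.IsMinConnecting B → G₁.IsMinConnecting A →
      (∀ e ≠ d₁, e ∈ A ↔ e ∈ B) → d₁ ∉ A → A = B := by
    intro A B hB hA hAB hd
    exact hB.eq_of_subset hA.connects fun e he => (hAB e (fun hh => hd (hh ▸ he))).1 he
  by_cases hd : d₁ ∈ U₁
  · by_cases hd' : d₁ ∈ W₁
    · ext e
      by_cases he : e = d₁
      · simp [he, hd, hd']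
      · exact hm e he
    · exact (key hU₁ hW₁ (fun e he => (hm e he).symm) hd').symm
  · exact key hW₁ hU₁ hm hd

theorem eq_of_gluePair_eq (h : IsAmalgam G G₁ G₂ d₁ d₂ x₁ y₁ x₂ y₂ φ₁ φ₂ ψ₁ ψ₂)
    (hp₁ : G₁.IsTreePair p₁) (hp₂ : G₂.IsTreePair p₂) (hq₁ : G₁.IsTreePair q₁)
    (hq₂ : G₂.IsTreePair q₂)
    (hg : gluePair d₁ d₂ ψ₁ ψ₂ p₁ p₂ = gluePair d₁ d₂ ψ₁ ψ₂ q₁ q₂) : p₁ = q₁ := by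
  obtain ⟨a1, a2, -, -⟩ := isTreePair_iff.1 hp₁
  obtain ⟨b1, b2, -, -⟩ := isTreePair_iff.1 hq₁
  exact Prod.ext
    (h.eq_of_glueSet_eq a1 b1 hp₂.1.1 hq₂.1.1 (congrArg Prod.fst hg))
    (h.eq_of_glueSet_eq a2 b2 hp₂.2.1.1 hq₂.2.1.1 (congrArg Prod.snd hg))

end IsAmalgam

end Exchanges

end Graph

namespace Graph

/-! ### Exchanges and unique exchanges, inside a part and across the seam. -/

section JoinIso

variable {α β α₁ α₂ β₁ β₂ : Type*}

theorem IsTreePair.partition_exchange {G : Graph α β} {p : Set β × Set β} (hp : G.IsTreePair p)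
    {e f : β} (he : e ∈ p.1) (hf : f ∈ p.2) :
    Disjoint (insert f (p.1 \ {e})) (insert e p.2 \ {f}) ∧
      insert f (p.1 \ {e}) ∪ (insert e p.2 \ {f}) = E(G) := by
  obtain ⟨-, -, hd, hu⟩ := hp
  rw [Set.disjoint_left] at hd ⊢
  grind

theorem IsTreePair.ncard_exchange {G : Graph α β} (hE : E(G).Finite) {p : Set β × Set β}
    (hp : G.IsTreePair p) {e f : β} (he : e ∈ p.1) (hf : f ∈ p.2) :
    (insert f (p.1 \ {e})).ncard = p.1.ncard ∧ (insert e p.2 \ {f}).ncard = p.2.ncard := by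
  have hd := Set.disjoint_left.1 hp.2.2.1
  have hef : e ≠ f := by grind
  refine ⟨ncard_insert_sdiff_singleton (hE.subset hp.1.1) he fun h => hd h hf, ?_⟩
  rw [← Set.insert_sdiff_singleton_comm hef]
  exact ncard_insert_sdiff_singleton (hE.subset hp.2.1.1) hf (hd he)

namespace IsAmalgam

variable {G : Graph α β} {G₁ : Graph α₁ β₁} {G₂ : Graph α₂ β₂} {d₁ : β₁} {d₂ : β₂}
    {x₁ y₁ : α₁} {x₂ y₂ : α₂} {φ₁ : α₁ → α} {φ₂ : α₂ → α} {ψ₁ : β₁ → β} {ψ₂ : β₂ → β}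
    {p₁ : Set β₁ × Set β₁} {p₂ : Set β₂ × Set β₂}

/-- The seam edges do not move, so the pair stays seam-split. An exchange preserves sizes, so
counting recovers the tree pairs of the parts from the glued one. -/
theorem isExchange_same_side (h : IsAmalgam G G₁ G₂ d₁ d₂ x₁ y₁ x₂ y₂ φ₁ φ₂ ψ₁ ψ₂)
    (hE : E(G).Finite) (hp₁ : G₁.IsTreePair p₁) (hp₂ : G₂.IsTreePair p₂)
    (hs : SeamSplit d₁ d₂ p₁ p₂) {e f : β₁} (he : e ∈ E(G₁) \ {d₁}) (hf : f ∈ E(G₁) \ {d₁}) :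
    G.IsExchange (gluePair d₁ d₂ ψ₁ ψ₂ p₁ p₂) (ψ₁ e) (ψ₁ f) ↔ G₁.IsExchange p₁ e f := by
  have a1 := hp₁.1.1
  have a2 := hp₁.2.1.1
  have b1 := hp₂.1.1
  have b2 := hp₂.2.1.1
  unfold IsExchange gluePair
  simp only
  rw [h.mem_glueSet₁ a1 b1 he, h.mem_glueSet₁ a2 b2 hf]
  refine and_congr_right fun he' => and_congr_right fun hf' => ?_
  rw [h.insert_glueSet_sdiff₁ a1 b1 he hf, h.insert_glueSet_sdiff₁' a2 b2 he hf]
  have hs' : SeamSplit d₁ d₂ (insert f (p₁.1 \ {e}), insert e p₁.2 \ {f}) p₂ := by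
    have h1 := he.2
    have h2 := hf.2
    unfold SeamSplit at *
    grind
  obtain ⟨k₁, k₂⟩ := hp₁.partition_exchange he' hf'
  obtain ⟨n₁, n₂⟩ := hp₁.ncard_exchange (h.finite_edgeSet₁ hE) he' hf'
  constructor
  · intro hm
    refine (h.isTreePair_of_gluePair hE k₁ k₂ hp₂.2.2.1 hp₂.2.2.2 hs' (fun T hT => ?_) hm).1
    simp only
    rw [n₁, n₂]
    exact hp₁.ncard_eq (h.finite_edgeSet₁ hE) hT
  · intro hm
    exact h.isTreePair_gluePair hm hp₂ hs'

theorem isExchange_across (h : IsAmalgam G G₁ G₂ d₁ d₂ x₁ y₁ x₂ y₂ φ₁ φ₂ ψ₁ ψ₂)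
    (hE : E(G).Finite) (h₁ : G₁.IsBispanning) (h₂ : G₂.IsBispanning) (hp₁ : G₁.IsTreePair p₁)
    (hp₂ : G₂.IsTreePair p₂) (hs : SeamSplit d₁ d₂ p₁ p₂) {e : β₁} {f : β₂}
    (he : e ∈ E(G₁) \ {d₁}) (hf : f ∈ E(G₂) \ {d₂}) :
    G.IsExchange (gluePair d₁ d₂ ψ₁ ψ₂ p₁ p₂) (ψ₁ e) (ψ₂ f) ↔
      G₁.IsExchange p₁ e d₁ ∧ G₂.IsExchange p₂ d₂ f := by
  have a1 := hp₁.1.1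
  have a2 := hp₁.2.1.1
  have b1 := hp₂.1.1
  have b2 := hp₂.2.1.1
  have hed := he.2
  have hfd := hf.2
  unfold IsExchange gluePair
  simp only
  rw [h.mem_glueSet₁ a1 b1 he, h.mem_glueSet₂ a2 b2 hf, h.insert_glueSet_sdiff₂ a1 b1 he hf,
    h.insert_glueSet_sdiff₂' a2 b2 he hf]
  rcases h.seam_cases hp₁.2.2.2 hp₂.2.2.2 hs with ⟨k1, k2, k3, k4⟩ | ⟨k1, k2, k3, k4⟩
  -- Here `d₁` lies in the same tree as `e`, and no exchange across is possible: off the seam, the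
  -- second trace in `G₁` would be the tree `p₁.2` enlarged by `e`, and thus would properly contain
  -- a spanning tree.
  · refine ⟨fun ⟨he', hf', hm⟩ => ?_, fun hh => absurd hh.1.2.1 k2⟩
    obtain ⟨q₁, q₂, hq₁, hq₂, -, hg⟩ := h.exists_of_isTreePair hE h₁ h₂ hm
    have hg' := congrArg Prod.snd hg
    simp only [gluePair] at hg'
    have hmem : ∀ g ∈ E(G₁) \ {d₁}, g ∈ q₁.2 ↔ g ∈ insert e p₁.2 \ {d₁} := by
      intro g hgE
      have c1 : insert e p₁.2 \ {d₁} ⊆ E(G₁) :=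
        Set.sdiff_subset.trans (Set.insert_subset he.1 a2)
      have c2 : insert d₂ p₂.2 \ {f} ⊆ E(G₂) :=
        Set.sdiff_subset.trans (Set.insert_subset h.isLink₂.edge_mem b2)
      rw [← h.mem_glueSet₁ hq₁.2.1.1 hq₂.2.1.1 hgE, hg', h.mem_glueSet₁ c1 c2 hgE]
    have hsub : p₁.2 ⊆ q₁.2 := fun g hgp =>
      (hmem g ⟨a2 hgp, fun hh => k2 (hh ▸ hgp)⟩).2 ⟨.inr hgp, fun hh => k2 (hh ▸ hgp)⟩
    have heq := (isTreePair_iff.1 hq₁).2.1.eq_of_subset (isTreePair_iff.1 hp₁).2.1.connects hsub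
    have heq₁ : e ∈ p₁.2 := heq ▸ (hmem e he).2 ⟨.inl rfl, hed⟩
    exact absurd heq₁ (Set.disjoint_left.1 hp₁.2.2.1 he')
  · have hs' : SeamSplit d₁ d₂ (insert d₁ (p₁.1 \ {e}), insert e p₁.2 \ {d₁})
        (insert f (p₂.1 \ {d₂}), insert d₂ p₂.2 \ {f}) := by
      unfold SeamSplit
      grind
    constructor
    · rintro ⟨he', hf', hm⟩
      obtain ⟨c₁, c₂⟩ := hp₁.partition_exchange he' k2
      obtain ⟨c₃, c₄⟩ := hp₂.partition_exchange k3 hf'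
      obtain ⟨n₁, n₂⟩ := hp₁.ncard_exchange (h.finite_edgeSet₁ hE) he' k2
      have := h.isTreePair_of_gluePair hE c₁ c₂ c₃ c₄ hs' (fun T hT => by
        simp only
        rw [n₁, n₂]
        exact hp₁.ncard_eq (h.finite_edgeSet₁ hE) hT) hm
      exact ⟨⟨he', k2, this.1⟩, ⟨k3, hf', this.2⟩⟩
    · rintro ⟨⟨he', -, hm₁⟩, ⟨-, hf', hm₂⟩⟩
      exact ⟨he', hf', h.isTreePair_gluePair hm₁ hm₂ hs'⟩

theorem exists_of_isExchange (h : IsAmalgam G G₁ G₂ d₁ d₂ x₁ y₁ x₂ y₂ φ₁ φ₂ ψ₁ ψ₂)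
    (hp₁ : G₁.IsTreePair p₁) (hp₂ : G₂.IsTreePair p₂) {e g : β}
    (hx : G.IsExchange (gluePair d₁ d₂ ψ₁ ψ₂ p₁ p₂) e g) :
    (∃ f ∈ E(G₁) \ {d₁}, ψ₁ f = g) ∨ (∃ f ∈ E(G₂) \ {d₂}, ψ₂ f = g) :=
  h.exists_of_mem g (h.glueSet_subset hp₁.2.1.1 hp₂.2.1.1 hx.2.1)

theorem isUniqueExchange_same_side (h : IsAmalgam G G₁ G₂ d₁ d₂ x₁ y₁ x₂ y₂ φ₁ φ₂ ψ₁ ψ₂)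
    (hE : E(G).Finite) (h₁ : G₁.IsBispanning) (h₂ : G₂.IsBispanning) (hp₁ : G₁.IsTreePair p₁)
    (hp₂ : G₂.IsTreePair p₂) (hs : SeamSplit d₁ d₂ p₁ p₂) {e f : β₁}
    (he : e ∈ E(G₁) \ {d₁}) (hf : f ∈ E(G₁) \ {d₁}) :
    G.IsUniqueExchange (gluePair d₁ d₂ ψ₁ ψ₂ p₁ p₂).1 (gluePair d₁ d₂ ψ₁ ψ₂ p₁ p₂).2
      (ψ₁ e) (ψ₁ f) ↔ G₁.IsUniqueExchange p₁.1 p₁.2 e f := by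
  rw [isUniqueExchange_iff, isUniqueExchange_iff, h.isExchange_same_side hE hp₁ hp₂ hs he hf]
  refine and_congr_right fun _ => ⟨fun hu g hg => ?_, fun hu g hg => ?_⟩
  -- The competitor `d₁` is invisible in `G`. Continuing it in `G₂` by an exchange of `d₂` with some
  -- `g₂` yields a visible competitor, the image of `g₂`.
  · by_cases hgd : g = d₁
    · subst hgd
      have hd₂ : d₂ ∈ p₂.1 := by
        rcases h.seam_cases hp₁.2.2.2 hp₂.2.2.2 hs with k | k
        exacts [absurd hg.2.1 k.2.1, k.2.2.1]
      obtain ⟨g₂, hg₂⟩ := hp₂.exists_isExchange hd₂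
      have hg₂E : g₂ ∈ E(G₂) \ {d₂} :=
        ⟨hp₂.2.1.1 hg₂.2.1, fun hh => Set.disjoint_left.1 hp₂.2.2.1 hd₂ (hh ▸ hg₂.2.1)⟩
      exact absurd (hu _ ((h.isExchange_across hE h₁ h₂ hp₁ hp₂ hs he hg₂E).2 ⟨hg, hg₂⟩)).symm
        (h.edge_ne f hf g₂ hg₂E)
    · have hgE : g ∈ E(G₁) \ {d₁} := ⟨hp₁.2.1.1 hg.2.1, hgd⟩
      exact h.injOn_edge₁ hgE hf
        (hu _ ((h.isExchange_same_side hE hp₁ hp₂ hs he hgE).2 hg))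
  · obtain ⟨g, hgE, rfl⟩ | ⟨g, hgE, rfl⟩ := h.exists_of_isExchange hp₁ hp₂ hg
    · rw [hu g ((h.isExchange_same_side hE hp₁ hp₂ hs he hgE).1 hg)]
    · have := hu _ ((h.isExchange_across hE h₁ h₂ hp₁ hp₂ hs he hgE).1 hg).1
      exact absurd this.symm hf.2

/-- The exchange partners of `e` in `G` are its partners in `G₁` other than `d₁` and, if `d₁` is a
partner, all partners of `d₂` in `G₂`. This set is a single edge of `G₂` exactly when both links of
the chain are unique. -/
theorem isUniqueExchange_across (h : IsAmalgam G G₁ G₂ d₁ d₂ x₁ y₁ x₂ y₂ φ₁ φ₂ ψ₁ ψ₂)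
    (hE : E(G).Finite) (h₁ : G₁.IsBispanning) (h₂ : G₂.IsBispanning) (hp₁ : G₁.IsTreePair p₁)
    (hp₂ : G₂.IsTreePair p₂) (hs : SeamSplit d₁ d₂ p₁ p₂) {e : β₁} {f : β₂}
    (he : e ∈ E(G₁) \ {d₁}) (hf : f ∈ E(G₂) \ {d₂}) :
    G.IsUniqueExchange (gluePair d₁ d₂ ψ₁ ψ₂ p₁ p₂).1 (gluePair d₁ d₂ ψ₁ ψ₂ p₁ p₂).2
      (ψ₁ e) (ψ₂ f) ↔
      G₁.IsUniqueExchange p₁.1 p₁.2 e d₁ ∧ G₂.IsUniqueExchange p₂.1 p₂.2 d₂ f := by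
  rw [isUniqueExchange_iff, isUniqueExchange_iff, isUniqueExchange_iff,
    h.isExchange_across hE h₁ h₂ hp₁ hp₂ hs he hf]
  constructor
  · rintro ⟨⟨hx₁, hx₂⟩, hu⟩
    refine ⟨⟨hx₁, fun g hg => ?_⟩, ⟨hx₂, fun g hg => ?_⟩⟩
    · by_contra hgd
      have hgE : g ∈ E(G₁) \ {d₁} := ⟨hp₁.2.1.1 hg.2.1, hgd⟩
      exact h.edge_ne g hgE f hf (hu _ ((h.isExchange_same_side hE hp₁ hp₂ hs he hgE).2 hg))
    · have hgE : g ∈ E(G₂) \ {d₂} :=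
        ⟨hp₂.2.1.1 hg.2.1, fun hh => Set.disjoint_left.1 hp₂.2.2.1 hg.1 (hh ▸ hg.2.1)⟩
      exact h.injOn_edge₂ hgE hf
        (hu _ ((h.isExchange_across hE h₁ h₂ hp₁ hp₂ hs he hgE).2 ⟨hx₁, hg⟩))
  · rintro ⟨⟨hx₁, hu₁⟩, ⟨hx₂, hu₂⟩⟩
    refine ⟨⟨hx₁, hx₂⟩, fun g hg => ?_⟩
    obtain ⟨g, hgE, rfl⟩ | ⟨g, hgE, rfl⟩ := h.exists_of_isExchange hp₁ hp₂ hg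
    · exact absurd (hu₁ g ((h.isExchange_same_side hE hp₁ hp₂ hs he hgE).1 hg)) hgE.2
    · rw [hu₂ g ((h.isExchange_across hE h₁ h₂ hp₁ hp₂ hs he hgE).1 hg).2]

/-- The vertex of the exchange graph of the amalgam given by a vertex of the join. -/
def glueVert (h : IsAmalgam G G₁ G₂ d₁ d₂ x₁ y₁ x₂ y₂ φ₁ φ₂ ψ₁ ψ₂)
    (q : JoinVert G₁ G₂ d₁ d₂) : G.TreePair :=
  ⟨gluePair d₁ d₂ ψ₁ ψ₂ q.1.1.1 q.1.2.1, h.isTreePair_gluePair q.1.1.2 q.1.2.2 q.2⟩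

theorem glueVert_bijective (h : IsAmalgam G G₁ G₂ d₁ d₂ x₁ y₁ x₂ y₂ φ₁ φ₂ ψ₁ ψ₂)
    (hE : E(G).Finite) (h₁ : G₁.IsBispanning) (h₂ : G₂.IsBispanning) :
    Function.Bijective h.glueVert := by
  constructor
  · intro q q' hq
    have hq' : gluePair d₁ d₂ ψ₁ ψ₂ q.1.1.1 q.1.2.1 = gluePair d₁ d₂ ψ₁ ψ₂ q'.1.1.1 q'.1.2.1 :=
      congrArg Subtype.val hq
    have e₁ := h.eq_of_gluePair_eq q.1.1.2 q.1.2.2 q'.1.1.2 q'.1.2.2 hq'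
    rw [gluePair_comm, gluePair_comm (p₁ := q'.1.1.1)] at hq'
    have e₂ := h.symm.eq_of_gluePair_eq q.1.2.2 q.1.1.2 q'.1.2.2 q'.1.1.2 hq'
    exact Subtype.ext (Prod.ext (Subtype.ext e₁) (Subtype.ext e₂))
  · rintro ⟨p, hp⟩
    obtain ⟨p₁, p₂, hp₁, hp₂, hs, hg⟩ := h.exists_of_isTreePair hE h₁ h₂ hp
    exact ⟨⟨(⟨p₁, hp₁⟩, ⟨p₂, hp₂⟩), hs⟩, Subtype.ext hg⟩

theorem isTauThreeArc_same_side (h : IsAmalgam G G₁ G₂ d₁ d₂ x₁ y₁ x₂ y₂ φ₁ φ₂ ψ₁ ψ₂)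
    (hE : E(G).Finite) (h₁ : G₁.IsBispanning) (h₂ : G₂.IsBispanning)
    (q : JoinVert G₁ G₂ d₁ d₂) {e f : β₁} (he : e ∈ E(G₁) \ {d₁}) (hf : f ∈ E(G₁) \ {d₁}) :
    G.IsTauThreeArc (ψ₁ e) (ψ₁ f) (h.glueVert q) ↔ G₁.IsTauThreeArc e f q.1.1 :=
  or_congr (h.isUniqueExchange_same_side hE h₁ h₂ q.1.1.2 q.1.2.2 q.2 he hf)
    (h.isUniqueExchange_same_side hE h₁ h₂ q.1.1.2.swap q.1.2.2.swap q.2.swap he hf)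

theorem isTauThreeArc_across (h : IsAmalgam G G₁ G₂ d₁ d₂ x₁ y₁ x₂ y₂ φ₁ φ₂ ψ₁ ψ₂)
    (hE : E(G).Finite) (h₁ : G₁.IsBispanning) (h₂ : G₂.IsBispanning)
    (q : JoinVert G₁ G₂ d₁ d₂) {e : β₁} {f : β₂} (he : e ∈ E(G₁) \ {d₁})
    (hf : f ∈ E(G₂) \ {d₂}) :
    G.IsTauThreeArc (ψ₁ e) (ψ₂ f) (h.glueVert q) ↔
      G₁.IsTauThreeArc e d₁ q.1.1 ∧ G₂.IsTauThreeArc d₂ f q.1.2 := by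
  refine (or_congr (h.isUniqueExchange_across hE h₁ h₂ q.1.1.2 q.1.2.2 q.2 he hf)
    (h.isUniqueExchange_across hE h₁ h₂ q.1.1.2.swap q.1.2.2.swap q.2.swap he hf)).trans ?_
  constructor
  · rintro (k | k)
    exacts [⟨.inl k.1, .inl k.2⟩, ⟨.inr k.1, .inr k.2⟩]
  · rintro ⟨k₁ | k₁, k₂ | k₂⟩
    · exact .inl ⟨k₁, k₂⟩
    -- Links in opposite directions would put both seam edges into trees of the same side.
    · exact absurd (.inr ⟨k₁.2.1, k₂.1⟩) q.2
    · exact absurd (.inl ⟨k₁.2.1, k₂.1⟩) q.2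
    · exact .inr ⟨k₁, k₂⟩

end IsAmalgam

end JoinIso

end Graph

namespace Graph

/-! ### Arcs and heads: assembling the isomorphism. -/

section JoinIso

variable {α β α₁ α₂ β₁ β₂ : Type*}

theorem IsTauThreeArc.mem_edgeSet {G : Graph α β} {e f : β} {p : G.TreePair}
    (h : G.IsTauThreeArc e f p) : e ∈ E(G) ∧ f ∈ E(G) := by
  rcases h with h | h
  · exact ⟨p.2.1.1 h.1, p.2.2.1.1 h.2.1⟩
  · exact ⟨p.2.2.1.1 h.1, p.2.1.1 h.2.1⟩

theorem IsTauThreeArc.ne {G : Graph α β} {e f : β} {p : G.TreePair}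
    (h : G.IsTauThreeArc e f p) : e ≠ f := by
  rintro rfl
  rcases h with h | h
  · exact Set.disjoint_left.1 p.2.2.2.1 h.1 h.2.1
  · exact Set.disjoint_left.1 p.2.2.2.1 h.2.1 h.1

theorem IsTauThreeArc.mem_iff {G : Graph α β} {e f : β} {p : G.TreePair}
    (h : G.IsTauThreeArc e f p) : e ∈ p.1.1 ↔ f ∈ p.1.2 := by
  have hd := Set.disjoint_left.1 p.2.2.2.1
  rcases h with h | h
  · exact ⟨fun _ => h.2.1, fun _ => h.1⟩
  · exact ⟨fun k => absurd h.1 (hd k), fun k => absurd k (hd h.2.1)⟩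

/-- The reversed isomorphism of directed multigraphs. -/
def _root_.DirectedMultigraph.Iso.symm {D D' : DirectedMultigraph} (i : D.Iso D') :
    D'.Iso D where
  vertEquiv := i.vertEquiv.symm
  arcEquiv := i.arcEquiv.symm
  inc_eq a := by
    obtain ⟨b, rfl⟩ := i.arcEquiv.surjective a
    rw [i.inc_eq, Equiv.symm_apply_apply, Prod.map_map]
    simp

namespace IsAmalgam

variable {G : Graph α β} {G₁ : Graph α₁ β₁} {G₂ : Graph α₂ β₂} {d₁ : β₁} {d₂ : β₂}
    {x₁ y₁ : α₁} {x₂ y₂ : α₂} {φ₁ : α₁ → α} {φ₂ : α₂ → α} {ψ₁ : β₁ → β} {ψ₂ : β₂ → β}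
    {p₁ : Set β₁ × Set β₁} {p₂ : Set β₂ × Set β₂}

theorem exchangePair_same_side (h : IsAmalgam G G₁ G₂ d₁ d₂ x₁ y₁ x₂ y₂ φ₁ φ₂ ψ₁ ψ₂)
    (hp₁ : G₁.IsTreePair p₁) (hp₂ : G₂.IsTreePair p₂) {e f : β₁} (he : e ∈ E(G₁) \ {d₁})
    (hf : f ∈ E(G₁) \ {d₁}) :
    exchangePair (ψ₁ e) (ψ₁ f) (gluePair d₁ d₂ ψ₁ ψ₂ p₁ p₂) =
      gluePair d₁ d₂ ψ₁ ψ₂ (exchangePair e f p₁) p₂ := by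
  have a1 := hp₁.1.1
  have a2 := hp₁.2.1.1
  have b1 := hp₂.1.1
  have b2 := hp₂.2.1.1
  have hm : ψ₁ e ∈ (gluePair d₁ d₂ ψ₁ ψ₂ p₁ p₂).1 ↔ e ∈ p₁.1 := h.mem_glueSet₁ a1 b1 he
  unfold exchangePair
  by_cases hep : e ∈ p₁.1
  · rw [if_pos hep, if_pos (hm.2 hep)]
    exact Prod.ext (h.insert_glueSet_sdiff₁ a1 b1 he hf) (h.insert_glueSet_sdiff₁' a2 b2 he hf)
  · rw [if_neg hep, if_neg (mt hm.1 hep)]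
    exact Prod.ext (h.insert_glueSet_sdiff₁' a1 b1 he hf) (h.insert_glueSet_sdiff₁ a2 b2 he hf)

theorem exchangePair_across (h : IsAmalgam G G₁ G₂ d₁ d₂ x₁ y₁ x₂ y₂ φ₁ φ₂ ψ₁ ψ₂)
    (hp₁ : G₁.IsTreePair p₁) (hp₂ : G₂.IsTreePair p₂) {e : β₁} {f : β₂}
    (he : e ∈ E(G₁) \ {d₁}) (hf : f ∈ E(G₂) \ {d₂}) (hed : e ∈ p₁.1 ↔ d₂ ∈ p₂.1) :
    exchangePair (ψ₁ e) (ψ₂ f) (gluePair d₁ d₂ ψ₁ ψ₂ p₁ p₂) =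
      gluePair d₁ d₂ ψ₁ ψ₂ (exchangePair e d₁ p₁) (exchangePair d₂ f p₂) := by
  have a1 := hp₁.1.1
  have a2 := hp₁.2.1.1
  have b1 := hp₂.1.1
  have b2 := hp₂.2.1.1
  have hm : ψ₁ e ∈ (gluePair d₁ d₂ ψ₁ ψ₂ p₁ p₂).1 ↔ e ∈ p₁.1 := h.mem_glueSet₁ a1 b1 he
  unfold exchangePair
  by_cases hep : e ∈ p₁.1
  · rw [if_pos hep, if_pos (hm.2 hep), if_pos (hed.1 hep)]
    exact Prod.ext (h.insert_glueSet_sdiff₂ a1 b1 he hf) (h.insert_glueSet_sdiff₂' a2 b2 he hf)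
  · rw [if_neg hep, if_neg (mt hm.1 hep), if_neg (mt hed.2 hep)]
    exact Prod.ext (h.insert_glueSet_sdiff₂' a1 b1 he hf) (h.insert_glueSet_sdiff₂ a2 b2 he hf)

/-- Both `e` and `d₂` lie opposite to `d₁`. Hence the two chained exchanges run in the same
direction and `exchangePair` takes the same branch for both. -/
theorem mem_iff_of_arcs (h : IsAmalgam G G₁ G₂ d₁ d₂ x₁ y₁ x₂ y₂ φ₁ φ₂ ψ₁ ψ₂)
    (q : JoinVert G₁ G₂ d₁ d₂) {e : β₁} (ha : G₁.IsTauThreeArc e d₁ q.1.1) :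
    e ∈ q.1.1.1.1 ↔ d₂ ∈ q.1.2.1.1 := by
  rw [ha.mem_iff]
  rcases h.seam_cases q.1.1.2.2.2.2 q.1.2.2.2.2.2 q.2 with k | k <;> tauto

/-- Makes the arcs that start with an edge of `G₂` mirror images of those that start in `G₁`. -/
theorem glueVert_symm (h : IsAmalgam G G₁ G₂ d₁ d₂ x₁ y₁ x₂ y₂ φ₁ φ₂ ψ₁ ψ₂)
    (q : JoinVert G₁ G₂ d₁ d₂) :
    h.symm.glueVert ⟨q.1.swap, q.2.symm⟩ = h.glueVert q :=
  Subtype.ext (gluePair_comm _ _ _ _ _ _)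

/-- The edges that survive in the amalgam. -/
def seamless (G₁ : Graph α₁ β₁) (G₂ : Graph α₂ β₂) (d₁ : β₁) (d₂ : β₂) : Set (β₁ ⊕ β₂) :=
  Sum.inl '' (E(G₁) \ {d₁}) ∪ Sum.inr '' (E(G₂) \ {d₂})

theorem injOn_seamless (h : IsAmalgam G G₁ G₂ d₁ d₂ x₁ y₁ x₂ y₂ φ₁ φ₂ ψ₁ ψ₂) :
    Set.InjOn (Sum.elim ψ₁ ψ₂) (seamless G₁ G₂ d₁ d₂) := by
  rintro _ (⟨e, he, rfl⟩ | ⟨e, he, rfl⟩) _ (⟨f, hf, rfl⟩ | ⟨f, hf, rfl⟩) hef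
  · exact congrArg Sum.inl (h.injOn_edge₁ he hf hef)
  · exact absurd hef (h.edge_ne e he f hf)
  · exact absurd hef.symm (h.edge_ne f hf e he)
  · exact congrArg Sum.inr (h.injOn_edge₂ he hf hef)

theorem exists_seamless (h : IsAmalgam G G₁ G₂ d₁ d₂ x₁ y₁ x₂ y₂ φ₁ φ₂ ψ₁ ψ₂) {e : β}
    (he : e ∈ E(G)) : ∃ z ∈ seamless G₁ G₂ d₁ d₂, Sum.elim ψ₁ ψ₂ z = e := by
  obtain ⟨f, hf, rfl⟩ | ⟨f, hf, rfl⟩ := h.exists_of_mem e he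
  exacts [⟨.inl f, .inl ⟨f, hf, rfl⟩, rfl⟩, ⟨.inr f, .inr ⟨f, hf, rfl⟩, rfl⟩]

/-- In a chain, the outer edges differ from the seam edges because exchanged edges lie in different
trees. -/
theorem seamless_of_isJoinArc (q : JoinVert G₁ G₂ d₁ d₂) {e f : β₁ ⊕ β₂}
    (ha : IsJoinArc d₁ d₂ q.1 e f) :
    e ∈ seamless G₁ G₂ d₁ d₂ ∧ f ∈ seamless G₁ G₂ d₁ d₂ := by
  rcases e with e | e <;> rcases f with f | f
  · have hm := ha.1.mem_edgeSet
    exact ⟨.inl ⟨e, ⟨hm.1, fun k => ha.2 (.inl k)⟩, rfl⟩,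
      .inl ⟨f, ⟨hm.2, fun k => ha.2 (.inr k)⟩, rfl⟩⟩
  · exact ⟨.inl ⟨e, ⟨ha.1.mem_edgeSet.1, ha.1.ne⟩, rfl⟩,
      .inr ⟨f, ⟨ha.2.mem_edgeSet.2, ha.2.ne.symm⟩, rfl⟩⟩
  · exact ⟨.inr ⟨e, ⟨ha.1.mem_edgeSet.1, ha.1.ne⟩, rfl⟩,
      .inl ⟨f, ⟨ha.2.mem_edgeSet.2, ha.2.ne.symm⟩, rfl⟩⟩
  · have hm := ha.1.mem_edgeSet
    exact ⟨.inr ⟨e, ⟨hm.1, fun k => ha.2 (.inl k)⟩, rfl⟩,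
      .inr ⟨f, ⟨hm.2, fun k => ha.2 (.inr k)⟩, rfl⟩⟩

theorem isTauThreeArc_iff_isJoinArc (h : IsAmalgam G G₁ G₂ d₁ d₂ x₁ y₁ x₂ y₂ φ₁ φ₂ ψ₁ ψ₂)
    (hE : E(G).Finite) (h₁ : G₁.IsBispanning) (h₂ : G₂.IsBispanning)
    (q : JoinVert G₁ G₂ d₁ d₂) {e f : β₁ ⊕ β₂} (he : e ∈ seamless G₁ G₂ d₁ d₂)
    (hf : f ∈ seamless G₁ G₂ d₁ d₂) :
    G.IsTauThreeArc (Sum.elim ψ₁ ψ₂ e) (Sum.elim ψ₁ ψ₂ f) (h.glueVert q) ↔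
      IsJoinArc d₁ d₂ q.1 e f := by
  obtain ⟨e, he, rfl⟩ | ⟨e, he, rfl⟩ := he <;> obtain ⟨f, hf, rfl⟩ | ⟨f, hf, rfl⟩ := hf
  · refine (h.isTauThreeArc_same_side hE h₁ h₂ q he hf).trans ⟨fun k => ⟨k, ?_⟩, And.left⟩
    exact fun k => k.elim he.2 hf.2
  · exact h.isTauThreeArc_across hE h₁ h₂ q he hf
  · rw [← h.glueVert_symm]
    exact h.symm.isTauThreeArc_across hE h₂ h₁ _ he hf
  · rw [← h.glueVert_symm]
    refine (h.symm.isTauThreeArc_same_side hE h₂ h₁ _ he hf).trans ⟨fun k => ⟨k, ?_⟩, And.left⟩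
    exact fun k => k.elim he.2 hf.2

theorem exchangePair_eq_joinHead (h : IsAmalgam G G₁ G₂ d₁ d₂ x₁ y₁ x₂ y₂ φ₁ φ₂ ψ₁ ψ₂)
    (q : JoinVert G₁ G₂ d₁ d₂) {e f : β₁ ⊕ β₂} (ha : IsJoinArc d₁ d₂ q.1 e f) :
    exchangePair (Sum.elim ψ₁ ψ₂ e) (Sum.elim ψ₁ ψ₂ f) (h.glueVert q).1 =
      (h.glueVert (joinHead q e f ha)).1 := by
  have hm := seamless_of_isJoinArc q ha
  obtain ⟨⟨e, he, rfl⟩ | ⟨e, he, rfl⟩, ⟨f, hf, rfl⟩ | ⟨f, hf, rfl⟩⟩ := hm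
  · exact h.exchangePair_same_side q.1.1.2 q.1.2.2 he hf
  · exact h.exchangePair_across q.1.1.2 q.1.2.2 he hf (h.mem_iff_of_arcs q ha.1)
  · rw [← h.glueVert_symm, ← h.glueVert_symm]
    exact h.symm.exchangePair_across q.1.2.2 q.1.1.2 he hf
      (h.symm.mem_iff_of_arcs ⟨q.1.swap, q.2.symm⟩ ha.1)
  · rw [← h.glueVert_symm, ← h.glueVert_symm]
    exact h.symm.exchangePair_same_side q.1.2.2 q.1.1.2 he hf

/-- The arc of the exchange graph of the amalgam given by an arc of the join. -/
noncomputable def glueArc (h : IsAmalgam G G₁ G₂ d₁ d₂ x₁ y₁ x₂ y₂ φ₁ φ₂ ψ₁ ψ₂)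
    (hE : E(G).Finite) (h₁ : G₁.IsBispanning) (h₂ : G₂.IsBispanning)
    (a : (tauThreeJoin G₁ G₂ d₁ d₂).Arc) : G.tauThree.Arc :=
  ⟨(Sum.elim ψ₁ ψ₂ a.1.1, Sum.elim ψ₁ ψ₂ a.1.2.1, h.glueVert a.1.2.2),
    (h.isTauThreeArc_iff_isJoinArc hE h₁ h₂ a.1.2.2 (seamless_of_isJoinArc _ a.2).1
      (seamless_of_isJoinArc _ a.2).2).2 a.2⟩

theorem glueArc_bijective (h : IsAmalgam G G₁ G₂ d₁ d₂ x₁ y₁ x₂ y₂ φ₁ φ₂ ψ₁ ψ₂)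
    (hE : E(G).Finite) (h₁ : G₁.IsBispanning) (h₂ : G₂.IsBispanning) :
    Function.Bijective (h.glueArc hE h₁ h₂) := by
  constructor
  · rintro ⟨⟨e, f, q⟩, ha⟩ ⟨⟨e', f', q'⟩, ha'⟩ hab
    have hab' := congrArg Subtype.val hab
    simp only [glueArc, Prod.mk.injEq] at hab'
    obtain ⟨k₁, k₂, k₃⟩ := hab'
    have hm := seamless_of_isJoinArc _ ha
    have hm' := seamless_of_isJoinArc _ ha'
    obtain rfl := h.injOn_seamless hm.1 hm'.1 k₁
    obtain rfl := h.injOn_seamless hm.2 hm'.2 k₂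
    obtain rfl := (h.glueVert_bijective hE h₁ h₂).1 k₃
    rfl
  · rintro ⟨⟨e, f, p⟩, ha⟩
    have ha' : G.IsTauThreeArc e f p := ha
    obtain ⟨z, hz, rfl⟩ := h.exists_seamless ha'.mem_edgeSet.1
    obtain ⟨w, hw, rfl⟩ := h.exists_seamless ha'.mem_edgeSet.2
    obtain ⟨q, rfl⟩ := (h.glueVert_bijective hE h₁ h₂).2 p
    exact ⟨⟨(z, w, q), (h.isTauThreeArc_iff_isJoinArc hE h₁ h₂ q hz hw).1 ha'⟩, rfl⟩

/-- The exchange graph of an amalgam is the join of the exchange graphs of its parts. -/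
noncomputable def joinIso (h : IsAmalgam G G₁ G₂ d₁ d₂ x₁ y₁ x₂ y₂ φ₁ φ₂ ψ₁ ψ₂)
    (hE : E(G).Finite) (h₁ : G₁.IsBispanning) (h₂ : G₂.IsBispanning) :
    (tauThreeJoin G₁ G₂ d₁ d₂).Iso G.tauThree where
  vertEquiv := Equiv.ofBijective h.glueVert (h.glueVert_bijective hE h₁ h₂)
  arcEquiv := Equiv.ofBijective (h.glueArc hE h₁ h₂) (h.glueArc_bijective hE h₁ h₂)
  inc_eq a := Prod.ext rfl (Subtype.ext (h.exchangePair_eq_joinHead a.1.2.2 a.2))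

end IsAmalgam

end JoinIso

/-! ### From a 2-clique sum to an amalgam. -/

section CliqueSum

variable {α β α₁ α₂ β₁ β₂ : Type*} {G₁ : Graph α₁ β₁} {G₂ : Graph α₂ β₂} {d₁ : β₁} {d₂ : β₂}
  {x₁ y₁ : α₁} {x₂ y₂ : α₂}

theorem twoCliqueSum_isLink_inl {e : β₁} {z w : α₁ ⊕ α₂} :
    (twoCliqueSum G₁ G₂ d₁ d₂ x₁ y₁ x₂ y₂).IsLink (.inl e) z w ↔
      e ≠ d₁ ∧ ∃ a b, G₁.IsLink e a b ∧ .inl a = z ∧ .inl b = w := by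
  simp only [twoCliqueSum, deleteEdges_isLink, map_isLink, Relation.Map, disjointUnion]
  constructor
  · rintro ⟨⟨a | a, b | b, hl, rfl, rfl⟩, hn⟩
    · exact ⟨by simpa using hn, a, b, hl, rfl, rfl⟩
    all_goals exact hl.elim
  · rintro ⟨hne, a, b, hl, rfl, rfl⟩
    exact ⟨⟨.inl a, .inl b, hl, rfl, rfl⟩, by simpa using hne⟩

theorem twoCliqueSum_isLink_inr {e : β₂} {z w : α₁ ⊕ α₂} :
    (twoCliqueSum G₁ G₂ d₁ d₂ x₁ y₁ x₂ y₂).IsLink (.inr e) z w ↔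
      e ≠ d₂ ∧ ∃ a b, G₂.IsLink e a b ∧ glue x₁ y₁ x₂ y₂ (.inr a) = z ∧
        glue x₁ y₁ x₂ y₂ (.inr b) = w := by
  simp only [twoCliqueSum, deleteEdges_isLink, map_isLink, Relation.Map, disjointUnion]
  constructor
  · rintro ⟨⟨a | a, b | b, hl, rfl, rfl⟩, hn⟩
    · exact hl.elim
    · exact hl.elim
    · exact hl.elim
    · exact ⟨by simpa using hn, a, b, hl, rfl, rfl⟩
  · rintro ⟨hne, a, b, hl, rfl, rfl⟩
    exact ⟨⟨.inr a, .inr b, hl, rfl, rfl⟩, by simpa using hne⟩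

theorem vertexSet_twoCliqueSum : V(twoCliqueSum G₁ G₂ d₁ d₂ x₁ y₁ x₂ y₂) =
    Sum.inl '' V(G₁) ∪ (fun v => glue x₁ y₁ x₂ y₂ (.inr v)) '' V(G₂) := by
  simp only [twoCliqueSum, vertexSet_deleteEdges, vertexSet_map, disjointUnion, Set.image_union,
    Set.image_image]
  rfl

theorem edgeSet_twoCliqueSum : E(twoCliqueSum G₁ G₂ d₁ d₂ x₁ y₁ x₂ y₂) =
    Sum.inl '' (E(G₁) \ {d₁}) ∪ Sum.inr '' (E(G₂) \ {d₂}) := by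
  ext (e | e)
  · rw [edge_mem_iff_exists_isLink]
    simp only [twoCliqueSum_isLink_inl]
    constructor
    · rintro ⟨_, _, hne, a, b, hl, rfl, rfl⟩
      exact .inl ⟨e, ⟨hl.edge_mem, hne⟩, rfl⟩
    · rintro (⟨f, hf, hfe⟩ | ⟨f, hf, hfe⟩)
      · obtain rfl := Sum.inl_injective hfe
        obtain ⟨a, b, hl⟩ := exists_isLink_of_mem_edgeSet hf.1
        exact ⟨_, _, hf.2, a, b, hl, rfl, rfl⟩
      · cases hfe
  · rw [edge_mem_iff_exists_isLink]
    simp only [twoCliqueSum_isLink_inr]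
    constructor
    · rintro ⟨_, _, hne, a, b, hl, rfl, rfl⟩
      exact .inr ⟨e, ⟨hl.edge_mem, hne⟩, rfl⟩
    · rintro (⟨f, hf, hfe⟩ | ⟨f, hf, hfe⟩)
      · cases hfe
      · obtain rfl := Sum.inr_injective hfe
        obtain ⟨a, b, hl⟩ := exists_isLink_of_mem_edgeSet hf.1
        exact ⟨_, _, hf.2, a, b, hl, rfl, rfl⟩

theorem glue_inr_injective (hne : x₁ ≠ y₁) :
    Function.Injective fun v => glue x₁ y₁ x₂ y₂ (.inr v) := by
  intro v w hvw
  simp only [glue] at hvw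
  grind

theorem inl_eq_glue_inr {a : α₁} {b : α₂} (h : Sum.inl a = glue x₁ y₁ x₂ y₂ (.inr b)) :
    (a = x₁ ∧ b = x₂) ∨ (a = y₁ ∧ b = y₂) := by
  simp only [glue] at h
  grind

theorem MultiIso.exists_isAmalgam {G : Graph α β} (hl₁ : G₁.IsLink d₁ x₁ y₁)
    (hl₂ : G₂.IsLink d₂ x₂ y₂) (hne₁ : x₁ ≠ y₁) (hne₂ : x₂ ≠ y₂) (hV : V(G).Nonempty)
    (hE : E(G).Nonempty) (i : MultiIso G (twoCliqueSum G₁ G₂ d₁ d₂ x₁ y₁ x₂ y₂)) :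
    ∃ φ₁ φ₂ ψ₁ ψ₂, IsAmalgam G G₁ G₂ d₁ d₂ x₁ y₁ x₂ y₂ φ₁ φ₂ ψ₁ ψ₂ := by
  classical
  obtain ⟨v₀, -⟩ := hV
  obtain ⟨e₀, -⟩ := hE
  set H := twoCliqueSum G₁ G₂ d₁ d₂ x₁ y₁ x₂ y₂ with hH
  -- The inverse bijections are extended to total maps. The defaults `v₀` and `e₀` are taken only
  -- outside the vertex and edge sets of the sum and play no role.
  let φ : α₁ ⊕ α₂ → α := fun z => if hz : z ∈ V(H) then i.vertexEquiv.symm ⟨z, hz⟩ else v₀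
  let ψ : β₁ ⊕ β₂ → β := fun z => if hz : z ∈ E(H) then i.edgeEquiv.symm ⟨z, hz⟩ else e₀
  have hφ : ∀ z (hz : z ∈ V(H)), φ z = i.vertexEquiv.symm ⟨z, hz⟩ := fun z hz => dif_pos hz
  have hψ : ∀ z (hz : z ∈ E(H)), ψ z = i.edgeEquiv.symm ⟨z, hz⟩ := fun z hz => dif_pos hz
  have hφinj : Set.InjOn φ V(H) := by
    intro z hz w hw hzw
    rw [hφ z hz, hφ w hw] at hzw
    exact congrArg Subtype.val (i.vertexEquiv.symm.injective (Subtype.ext hzw))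
  have hψinj : Set.InjOn ψ E(H) := by
    intro z hz w hw hzw
    rw [hψ z hz, hψ w hw] at hzw
    exact congrArg Subtype.val (i.edgeEquiv.symm.injective (Subtype.ext hzw))
  have hlink : ∀ e z w, H.IsLink e z w → G.IsLink (ψ e) (φ z) (φ w) := by
    intro e z w hl
    rw [hψ e hl.edge_mem, hφ z hl.left_mem, hφ w hl.right_mem, i.isLink_iff]
    simpa using hl
  have hVH : V(H) = _ := vertexSet_twoCliqueSum
  have hEH : E(H) = _ := edgeSet_twoCliqueSum
  have hv₁ : ∀ a ∈ V(G₁), Sum.inl a ∈ V(H) := fun a ha => hVH ▸ .inl ⟨a, ha, rfl⟩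
  have hv₂ : ∀ a ∈ V(G₂), glue x₁ y₁ x₂ y₂ (.inr a) ∈ V(H) := fun a ha => hVH ▸ .inr ⟨a, ha, rfl⟩
  have he₁ : ∀ e ∈ E(G₁) \ {d₁}, Sum.inl e ∈ E(H) := fun e he => hEH ▸ .inl ⟨e, he, rfl⟩
  have he₂ : ∀ e ∈ E(G₂) \ {d₂}, Sum.inr e ∈ E(H) := fun e he => hEH ▸ .inr ⟨e, he, rfl⟩
  refine ⟨fun a => φ (.inl a), fun a => φ (glue x₁ y₁ x₂ y₂ (.inr a)), fun e => ψ (.inl e),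
    fun e => ψ (.inr e), hl₁, hl₂, hne₁, hne₂, ?_, ?_, ?_, ?_, ?_, ?_, ?_, ?_, ?_, ?_, ?_, ?_⟩
  · exact fun a ha b hb hab => Sum.inl_injective (hφinj (hv₁ a ha) (hv₁ b hb) hab)
  · exact fun a ha b hb hab => glue_inr_injective hne₁ (hφinj (hv₂ a ha) (hv₂ b hb) hab)
  · simp [glue]
  · simp [glue, hne₂.symm]
  · exact fun a ha b hb hab => inl_eq_glue_inr (hφinj (hv₁ a ha) (hv₂ b hb) hab)
  · ext v
    constructor
    · intro hv
      have hm := (i.vertexEquiv ⟨v, hv⟩).2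
      have hφv : φ (i.vertexEquiv ⟨v, hv⟩) = v := by simp [hφ _ hm]
      rcases hVH.subset hm with ⟨a, ha, hav⟩ | ⟨a, ha, hav⟩
      · exact .inl ⟨a, ha, (congrArg φ hav).trans hφv⟩
      · exact .inr ⟨a, ha, (congrArg φ hav).trans hφv⟩
    · rintro (⟨a, ha, rfl⟩ | ⟨a, ha, rfl⟩)
      · simp only [hφ _ (hv₁ a ha)]
        exact Subtype.coe_prop _
      · simp only [hφ _ (hv₂ a ha)]
        exact Subtype.coe_prop _
  · exact fun a ha b hb hab => Sum.inl_injective (hψinj (he₁ a ha) (he₁ b hb) hab)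
  · exact fun a ha b hb hab => Sum.inr_injective (hψinj (he₂ a ha) (he₂ b hb) hab)
  · exact fun a ha b hb hab => Sum.inl_ne_inr (hψinj (he₁ a ha) (he₂ b hb) hab)
  · exact fun f a b hf hl => hlink _ _ _ (twoCliqueSum_isLink_inl.2 ⟨hf, a, b, hl, rfl, rfl⟩)
  · exact fun f a b hf hl => hlink _ _ _ (twoCliqueSum_isLink_inr.2 ⟨hf, a, b, hl, rfl, rfl⟩)
  · intro e he
    have hm := (i.edgeEquiv ⟨e, he⟩).2
    have hψe : ψ (i.edgeEquiv ⟨e, he⟩) = e := by simp [hψ _ hm]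
    rcases hEH.subset hm with ⟨a, ha, hae⟩ | ⟨a, ha, hae⟩
    · exact .inl ⟨a, ha, (congrArg ψ hae).trans hψe⟩
    · exact .inr ⟨a, ha, (congrArg ψ hae).trans hψe⟩

end CliqueSum

end Graph

namespace Graph

/-! ### From an amalgam back to a 2-clique sum. -/

section CliqueSum

variable {α β α₁ α₂ β₁ β₂ : Type*} {G : Graph α β} {G₁ : Graph α₁ β₁} {G₂ : Graph α₂ β₂}
  {d₁ : β₁} {d₂ : β₂} {x₁ y₁ : α₁} {x₂ y₂ : α₂} {φ₁ : α₁ → α} {φ₂ : α₂ → α} {ψ₁ : β₁ → β}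
  {ψ₂ : β₂ → β}

theorem IsAmalgam.elim_glue (h : IsAmalgam G G₁ G₂ d₁ d₂ x₁ y₁ x₂ y₂ φ₁ φ₂ ψ₁ ψ₂) (v : α₂) :
    Sum.elim φ₁ φ₂ (glue x₁ y₁ x₂ y₂ (.inr v)) = φ₂ v := by
  simp only [glue]
  split_ifs with hx hy
  · rw [hx]
    exact h.map_left
  · rw [hy]
    exact h.map_right
  · rfl

theorem IsAmalgam.bijOn_vertexSet (h : IsAmalgam G G₁ G₂ d₁ d₂ x₁ y₁ x₂ y₂ φ₁ φ₂ ψ₁ ψ₂) :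
    Set.BijOn (Sum.elim φ₁ φ₂) V(twoCliqueSum G₁ G₂ d₁ d₂ x₁ y₁ x₂ y₂) V(G) := by
  have hov : ∀ a ∈ V(G₁), ∀ b ∈ V(G₂), φ₁ a = φ₂ b →
      Sum.inl a = glue x₁ y₁ x₂ y₂ (.inr b) := by
    intro a ha b hb hab
    obtain ⟨rfl, rfl⟩ | ⟨rfl, rfl⟩ := h.overlap a ha b hb hab
    · simp [glue]
    · simp [glue, h.ne₂.symm]
  rw [vertexSet_twoCliqueSum]
  refine ⟨?_, ?_, ?_⟩
  · rw [h.vertexSet_eq]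
    rintro _ (⟨a, ha, rfl⟩ | ⟨a, ha, rfl⟩)
    · exact .inl ⟨a, ha, rfl⟩
    · exact .inr ⟨a, ha, (h.elim_glue a).symm⟩
  · rintro _ (⟨a, ha, rfl⟩ | ⟨a, ha, rfl⟩) _ (⟨b, hb, rfl⟩ | ⟨b, hb, rfl⟩) hab
    · exact congrArg _ (h.injOn_vert₁ ha hb hab)
    · exact hov a ha b hb (hab.trans (h.elim_glue b))
    · exact (hov b hb a ha (hab.symm.trans (h.elim_glue a))).symm
    · simp only [h.elim_glue] at hab
      simp only [h.injOn_vert₂ ha hb hab]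
  · rw [h.vertexSet_eq]
    rintro _ (⟨a, ha, rfl⟩ | ⟨a, ha, rfl⟩)
    · exact ⟨.inl a, .inl ⟨a, ha, rfl⟩, rfl⟩
    · exact ⟨_, .inr ⟨a, ha, rfl⟩, h.elim_glue a⟩

theorem IsAmalgam.bijOn_edgeSet (h : IsAmalgam G G₁ G₂ d₁ d₂ x₁ y₁ x₂ y₂ φ₁ φ₂ ψ₁ ψ₂) :
    Set.BijOn (Sum.elim ψ₁ ψ₂) E(twoCliqueSum G₁ G₂ d₁ d₂ x₁ y₁ x₂ y₂) E(G) := by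
  rw [edgeSet_twoCliqueSum]
  refine ⟨?_, h.injOn_seamless, fun e he => h.exists_seamless he⟩
  rintro _ (⟨e, he, rfl⟩ | ⟨e, he, rfl⟩)
  exacts [h.map_mem₁ he, h.symm.map_mem₁ he]

theorem IsAmalgam.isLink_elim_iff (h : IsAmalgam G G₁ G₂ d₁ d₂ x₁ y₁ x₂ y₂ φ₁ φ₂ ψ₁ ψ₂)
    {e : β₁ ⊕ β₂} (he : e ∈ E(twoCliqueSum G₁ G₂ d₁ d₂ x₁ y₁ x₂ y₂)) {z w : α₁ ⊕ α₂}
    (hz : z ∈ V(twoCliqueSum G₁ G₂ d₁ d₂ x₁ y₁ x₂ y₂))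
    (hw : w ∈ V(twoCliqueSum G₁ G₂ d₁ d₂ x₁ y₁ x₂ y₂)) :
    (twoCliqueSum G₁ G₂ d₁ d₂ x₁ y₁ x₂ y₂).IsLink e z w ↔
      G.IsLink (Sum.elim ψ₁ ψ₂ e) (Sum.elim φ₁ φ₂ z) (Sum.elim φ₁ φ₂ w) := by
  have hinj := h.bijOn_vertexSet.injOn
  rw [edgeSet_twoCliqueSum] at he
  obtain ⟨e, he, rfl⟩ | ⟨e, he, rfl⟩ := he
  · rw [twoCliqueSum_isLink_inl]
    constructor
    · rintro ⟨hne, a, b, hl, rfl, rfl⟩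
      exact h.isLink_map₁ e a b hne hl
    · intro hl
      obtain ⟨a, b, hab, haz, hbw⟩ := h.isLink_of_image he hl
      refine ⟨he.2, a, b, hab, hinj ?_ hz haz, hinj ?_ hw hbw⟩
      all_goals rw [vertexSet_twoCliqueSum]
      exacts [.inl ⟨a, hab.left_mem, rfl⟩, .inl ⟨b, hab.right_mem, rfl⟩]
  · rw [twoCliqueSum_isLink_inr]
    constructor
    · rintro ⟨hne, a, b, hl, rfl, rfl⟩
      rw [h.elim_glue, h.elim_glue]
      exact h.isLink_map₂ e a b hne hl
    · intro hl
      obtain ⟨a, b, hab, haz, hbw⟩ := h.symm.isLink_of_image he hl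
      refine ⟨he.2, a, b, hab, hinj ?_ hz ((h.elim_glue a).trans haz),
        hinj ?_ hw ((h.elim_glue b).trans hbw)⟩
      all_goals rw [vertexSet_twoCliqueSum]
      exacts [.inr ⟨a, hab.left_mem, rfl⟩, .inr ⟨b, hab.right_mem, rfl⟩]

theorem IsAmalgam.isTwoCliqueSum (h : IsAmalgam G G₁ G₂ d₁ d₂ x₁ y₁ x₂ y₂ φ₁ φ₂ ψ₁ ψ₂) :
    G.IsTwoCliqueSum G₁ G₂ d₁ d₂ := by
  refine ⟨x₁, y₁, x₂, y₂, h.isLink₁, h.isLink₂, ⟨?_⟩⟩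
  refine ⟨(h.bijOn_vertexSet.equiv _).symm, (h.bijOn_edgeSet.equiv _).symm, fun e x y => ?_⟩
  obtain ⟨e, rfl⟩ := (h.bijOn_edgeSet.equiv _).surjective e
  obtain ⟨x, rfl⟩ := (h.bijOn_vertexSet.equiv _).surjective x
  obtain ⟨y, rfl⟩ := (h.bijOn_vertexSet.equiv _).surjective y
  simp only [Equiv.symm_apply_apply]
  exact (h.isLink_elim_iff e.2 x.2 y.2).symm

end CliqueSum

/-! ### Relabelling the edges of spanning trees. -/

section MapEdges

variable {α β γ : Type*} {G : Graph α β} {K : Graph α γ} {ρ : β → γ} {U W : Set β}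

theorem Reach.mapEdges (hK : ∀ e ∈ U, ∀ a b, G.IsLink e a b → K.IsLink (ρ e) a b) {a b : α}
    (h : G.Reach U a b) : K.Reach (ρ '' U) a b := by
  induction h with
  | refl => exact .refl _ _ _
  | tail _ h ih =>
    obtain ⟨e, he, h⟩ := h
    exact ih.trans ((hK e he _ _ h).reach ⟨e, he, rfl⟩)

theorem Reach.of_mapEdges (hU : U ⊆ E(G))
    (hK : ∀ e ∈ U, ∀ a b, G.IsLink e a b → K.IsLink (ρ e) a b) {a b : α}
    (h : K.Reach (ρ '' U) a b) : G.Reach U a b := by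
  induction h with
  | refl => exact .refl _ _ _
  | tail _ h ih =>
    obtain ⟨_, ⟨e, he, rfl⟩, h⟩ := h
    obtain ⟨u, v, huv⟩ := exists_isLink_of_mem_edgeSet (hU he)
    refine ih.trans ?_
    obtain ⟨rfl, rfl⟩ | ⟨rfl, rfl⟩ := (hK e he _ _ huv).eq_and_eq_or_eq_and_eq h
    exacts [huv.reach he, huv.symm.reach he]

theorem IsMinConnecting.mapEdges (hU : G.IsMinConnecting U) (hV : V(G) = V(K))
    (hK : ∀ e ∈ U, ∀ a b, G.IsLink e a b → K.IsLink (ρ e) a b) :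
    K.IsMinConnecting (ρ '' U) := by
  refine ⟨?_, ⟨hV ▸ hU.connects.1, ?_⟩, ?_⟩
  · rintro _ ⟨e, he, rfl⟩
    obtain ⟨u, v, huv⟩ := exists_isLink_of_mem_edgeSet (hU.subset_edgeSet he)
    exact (hK e he u v huv).edge_mem
  · rw [← hV]
    exact fun x hx y hy => (hU.connects.2 x hx y hy).mapEdges hK
  · rintro _ ⟨e, he, rfl⟩ hc
    refine hU.not_connects e he ⟨hU.connects.1, fun x hx y hy => ?_⟩
    refine Reach.of_mapEdges (ρ := ρ) (K := K) (Set.sdiff_subset.trans hU.subset_edgeSet)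
      (fun f hf => hK f hf.1) ((hc.2 x (hV ▸ hx) y (hV ▸ hy)).mono ?_)
    rintro _ ⟨⟨f, hf, rfl⟩, hne⟩
    exact ⟨f, ⟨hf, fun hh => hne (congrArg ρ hh)⟩, rfl⟩

/-- Serves to read two trees of a part with a seam edge as trees of a subgraph of `G`, where the
seam edge is either unused or replaced by a genuine edge. -/
theorem IsMinConnecting.isBispanning_mapEdges {S T : Set β} (hS : G.IsMinConnecting S)
    (hT : G.IsMinConnecting T) (hd : Disjoint S T) (hV : V(G) = V(K))
    (hK : ∀ e ∈ S ∪ T, ∀ a b, G.IsLink e a b → K.IsLink (ρ e) a b)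
    (hρ : Set.InjOn ρ (S ∪ T)) (hE : E(K) = ρ '' (S ∪ T)) : K.IsBispanning := by
  refine ⟨(ρ '' S, ρ '' T), isTreePair_iff.2 ⟨?_, ?_, ?_, ?_⟩⟩
  · exact hS.mapEdges hV (fun e he => hK e (.inl he))
  · exact hT.mapEdges hV (fun e he => hK e (.inr he))
  · exact hd.image hρ Set.subset_union_left Set.subset_union_right
  · rw [hE, Set.image_union]

end MapEdges

end Graph

namespace Graph

/-! ### Splitting an atomic bispanning graph at a separating pair. -/

section Separation

variable {α β : Type*} {G : Graph α β} {A B : Set α} {F : Set β} {x y : α}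

/-- The part of `G` with vertex set `A` and edge set `F`. -/
def part (G : Graph α β) (A : Set α) (F : Set β) : Graph α β := (G.restrict F).induce A

/-- The part of `G` with vertex set `A` and edge set `F`, and an extra edge `none` from `x` to
`y`. -/
def seamPart (G : Graph α β) (A : Set α) (F : Set β) (x y : α) : Graph α (Option β) where
  vertexSet := insert x (insert y A)
  IsLink
    | some e, a, b => (G.part A F).IsLink e a b
    | none, a, b => (a = x ∧ b = y) ∨ (a = y ∧ b = x)
  isLink_symm := by
    rintro (_ | e) - <;> constructor <;> intro a b h
    · exact h.symm.imp And.symm And.symm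
    · exact IsLink.symm h
  eq_or_eq_of_isLink_of_isLink := by
    rintro (_ | e) a b c d h h'
    · grind
    · exact IsLink.left_eq_or_eq h h'
  left_mem_of_isLink := by
    rintro (_ | e) a b h
    · grind
    · exact .inr (.inr h.2.1)

theorem vertexSet_seamPart (hx : x ∈ A) (hy : y ∈ A) : V(G.seamPart A F x y) = A := by
  change insert x (insert y A) = A
  rw [Set.insert_eq_of_mem hy, Set.insert_eq_of_mem hx]

theorem part_le (hA : A ⊆ V(G)) : G.part A F ≤ G := ⟨hA, fun _ _ _ h => h.1.2⟩

/-- `A` and `B` cover the vertices and meet in `{x, y}`; the edges in `F` run inside `A`, all others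
inside `B`. -/
structure IsSeparation (G : Graph α β) (A B : Set α) (F : Set β) (x y : α) : Prop where
  ne : x ≠ y
  union_eq : A ∪ B = V(G)
  inter_eq : A ∩ B = {x, y}
  subset_edgeSet : F ⊆ E(G)
  mem_left : ∀ e ∈ F, ∀ a b, G.IsLink e a b → a ∈ A
  mem_right : ∀ e ∉ F, ∀ a b, G.IsLink e a b → a ∈ B

namespace IsSeparation

theorem symm (h : IsSeparation G A B F x y) : IsSeparation G B A (E(G) \ F) x y where
  ne := h.ne
  union_eq := by rw [Set.union_comm, h.union_eq]
  inter_eq := by rw [Set.inter_comm, h.inter_eq]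
  subset_edgeSet := Set.sdiff_subset
  mem_left e he := h.mem_right e he.2
  mem_right e he a b hl := h.mem_left e (by_contra fun k => he ⟨hl.edge_mem, k⟩) a b hl

theorem left_mem (h : IsSeparation G A B F x y) : x ∈ A ∧ x ∈ B :=
  h.inter_eq.superset (.inl rfl)

theorem right_mem (h : IsSeparation G A B F x y) : y ∈ A ∧ y ∈ B :=
  h.inter_eq.superset (.inr rfl)

theorem vertexSet_seamPart (h : IsSeparation G A B F x y) : V(G.seamPart A F x y) = A :=
  Graph.vertexSet_seamPart h.left_mem.1 h.right_mem.1

theorem seamPart_isLink_some (h : IsSeparation G A B F x y) {e : β} {a b : α} :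
    (G.seamPart A F x y).IsLink (some e) a b ↔ e ∈ F ∧ G.IsLink e a b :=
  ⟨And.left, fun k => ⟨k, h.mem_left e k.1 a b k.2, h.mem_left e k.1 b a k.2.symm⟩⟩

theorem edgeSet_seamPart (h : IsSeparation G A B F x y) :
    E(G.seamPart A F x y) = insert none (some '' F) := by
  ext (_ | e)
  · simp only [Set.mem_insert_iff, true_or, iff_true]
    exact IsLink.edge_mem (x := x) (y := y) (.inl ⟨rfl, rfl⟩)
  · rw [edge_mem_iff_exists_isLink]
    simp only [h.seamPart_isLink_some]
    constructor
    · rintro ⟨a, b, hl⟩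
      exact .inr ⟨e, hl.1, rfl⟩
    · rintro (hh | ⟨f, hf, hfe⟩)
      · cases hh
      · obtain rfl := Option.some_injective _ hfe
        obtain ⟨a, b, hl⟩ := exists_isLink_of_mem_edgeSet (h.subset_edgeSet hf)
        exact ⟨a, b, hf, hl⟩

theorem edgeSet_seamPart_sdiff (h : IsSeparation G A B F x y) :
    E(G.seamPart A F x y) \ {none} = some '' F := by
  rw [h.edgeSet_seamPart]
  exact Set.insert_sdiff_self_of_notMem (by simp)

theorem edgeSet_part (h : IsSeparation G A B F x y) : E(G.part A F) = F := by
  ext e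
  rw [edge_mem_iff_exists_isLink]
  constructor
  · rintro ⟨a, b, hl⟩
    exact hl.1.1
  · intro he
    obtain ⟨a, b, hl⟩ := exists_isLink_of_mem_edgeSet (h.subset_edgeSet he)
    exact ⟨a, b, ⟨he, hl⟩, h.mem_left e he a b hl, h.mem_left e he b a hl.symm⟩

theorem injOn_getD (F : Set β) (e₀ : β) :
    Set.InjOn (fun o : Option β => o.getD e₀) (some '' F) := by
  rintro _ ⟨e, -, rfl⟩ _ ⟨f, -, rfl⟩ hef
  exact congrArg some hef

/-- The edge `e₀` is a dummy value at the seam edge `none`, which every condition on edge maps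
leaves out. -/
theorem isAmalgam (h : IsSeparation G A B F x y) (e₀ : β) :
    IsAmalgam G (G.seamPart A F x y) (G.seamPart B (E(G) \ F) x y) none none x y x y id id
      (fun o => o.getD e₀) (fun o => o.getD e₀) where
  isLink₁ := .inl ⟨rfl, rfl⟩
  isLink₂ := .inl ⟨rfl, rfl⟩
  ne₁ := h.ne
  ne₂ := h.ne
  injOn_vert₁ := Function.injective_id.injOn
  injOn_vert₂ := Function.injective_id.injOn
  map_left := rfl
  map_right := rfl
  overlap a ha b hb hab := by
    obtain rfl : a = b := hab
    rw [h.vertexSet_seamPart] at ha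
    rw [h.symm.vertexSet_seamPart] at hb
    have hm : a ∈ A ∩ B := ⟨ha, hb⟩
    rw [h.inter_eq] at hm
    exact hm.imp (fun k => ⟨k, k⟩) (fun k => ⟨k, k⟩)
  vertexSet_eq := by
    rw [h.vertexSet_seamPart, h.symm.vertexSet_seamPart, Set.image_id, Set.image_id, h.union_eq]
  injOn_edge₁ := by
    rw [h.edgeSet_seamPart_sdiff]
    exact injOn_getD _ _
  injOn_edge₂ := by
    rw [h.symm.edgeSet_seamPart_sdiff]
    exact injOn_getD _ _
  edge_ne := by
    rw [h.edgeSet_seamPart_sdiff, h.symm.edgeSet_seamPart_sdiff]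
    rintro _ ⟨e, he, rfl⟩ _ ⟨f, hf, rfl⟩ (rfl : e = f)
    exact hf.2 he
  isLink_map₁ := by
    rintro (_ | e) a b hne hl
    · exact absurd rfl hne
    · exact hl.1.2
  isLink_map₂ := by
    rintro (_ | e) a b hne hl
    · exact absurd rfl hne
    · exact hl.1.2
  exists_of_mem e he := by
    rw [h.edgeSet_seamPart_sdiff, h.symm.edgeSet_seamPart_sdiff]
    by_cases heF : e ∈ F
    · exact .inl ⟨some e, ⟨e, heF, rfl⟩, rfl⟩
    · exact .inr ⟨some e, ⟨e, ⟨he, heF⟩, rfl⟩, rfl⟩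

theorem simple_seamPart (h : IsSeparation G A B F x y) (hG : G.Simple)
    (hxy : ∀ e, ¬ G.IsLink e x y) : (G.seamPart A F x y).Simple where
  not_isLoopAt := by
    rintro (_ | e) a hl
    · have := h.ne
      rcases hl with hl | hl <;> grind
    · exact G.not_isLoopAt e a hl.1.2
  eq_of_isLink := by
    have key : ∀ e a b, (G.seamPart A F x y).IsLink none a b → ¬ G.IsLink e a b := by
      rintro e a b (⟨rfl, rfl⟩ | ⟨rfl, rfl⟩) hl
      exacts [hxy e hl, hxy e hl.symm]
    rintro (_ | e) (_ | f) a b he hf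
    · rfl
    · exact absurd hf.1.2 (key f a b he)
    · exact absurd he.1.2 (key e a b hf)
    · exact congrArg some (he.1.2.eq hf.1.2)

/-- A part of an atomic graph with at least two, but not all vertices is not bispanning. -/
theorem not_isBispanning_part (h : IsSeparation G A B F x y) (hG : G.IsAtomicBispanning)
    {v : α} (hv : v ∈ V(G)) (hvA : v ∉ A) (F' : Set β) : ¬ (G.part A F').IsBispanning := by
  intro hb
  have hA : A ⊆ V(G) := h.union_eq ▸ Set.subset_union_left
  rcases hG.2 _ (part_le hA) hb with hK | ⟨w, hw⟩
  · have hV : A = V(G) := congrArg vertexSet hK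
    exact hvA (hV ▸ hv)
  · have hV : A = {w} := congrArg vertexSet hw
    have hx := h.left_mem.1
    have hy := h.right_mem.1
    rw [hV] at hx hy
    exact h.ne (hx.trans hy.symm)

/-- Two such trees avoid the seam edge, so they would make the part on `A` a bispanning subgraph of
`G` that misses `v` but contains `x` and `y`, against atomicity. -/
theorem not_isMinConnecting_and (h : IsSeparation G A B F x y) (hG : G.IsAtomicBispanning)
    {v : α} (hv : v ∈ V(G)) (hvA : v ∉ A) {S T : Set (Option β)}
    (hS : (G.seamPart A F x y).IsMinConnecting S) (hT : (G.seamPart A F x y).IsMinConnecting T)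
    (hd : Disjoint S T) : S ∪ T ≠ E(G.seamPart A F x y) \ {none} := by
  intro hu
  rw [h.edgeSet_seamPart_sdiff] at hu
  obtain ⟨e₀, -⟩ | hF := F.eq_empty_or_nonempty.symm
  · refine h.not_isBispanning_part hG hv hvA F
      (hS.isBispanning_mapEdges (ρ := fun o => o.getD e₀) hT hd h.vertexSet_seamPart ?_ ?_ ?_)
    · rw [hu]
      rintro _ ⟨e, he, rfl⟩ a b hl
      exact hl
    · rw [hu]
      exact injOn_getD _ _
    · rw [hu, h.edgeSet_part, Set.image_image]
      simp
  -- With no edges at all, `S` is empty and cannot join `x` to `y`.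
  · have hxA : x ∈ V(G.seamPart A F x y) := .inl rfl
    have hyA : y ∈ V(G.seamPart A F x y) := .inr (.inl rfl)
    have hS' : S = ∅ := by
      rw [hF, Set.image_empty] at hu
      exact (Set.union_empty_iff.1 hu).1
    obtain ⟨f, hf, -⟩ := (hS.connects.2 x hxA y hyA).exists_crossing (· = x) rfl h.ne.symm
    simp [hS'] at hf

/-- The same case split as in `IsAmalgam.exists_of_isTreePair`, but the parts are not yet known to
be bispanning. Atomicity, instead of counting, rules out equal choices of the two trees. -/
theorem isBispanning_seamParts (h : IsSeparation G A B F x y) (hG : G.IsAtomicBispanning)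
    {u v : α} (hu : u ∈ V(G)) (huB : u ∉ B) (hv : v ∈ V(G)) (hvA : v ∉ A) (e₀ : β) :
    (G.seamPart A F x y).IsBispanning ∧ (G.seamPart B (E(G) \ F) x y).IsBispanning := by
  have hm := h.isAmalgam e₀
  obtain ⟨⟨S, T⟩, hp⟩ := hG.1
  obtain ⟨hS, hT, hd, hun⟩ := isTreePair_iff.1 hp
  simp only at hS hT hd hun
  obtain ⟨S₁, hS₁, S₂, hS₂, rfl⟩ := hm.exists_glueSet_eq hS.subset_edgeSet
  obtain ⟨T₁, hT₁, T₂, hT₂, rfl⟩ := hm.exists_glueSet_eq hT.subset_edgeSet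
  obtain ⟨hd₁, hu₁⟩ := hm.partition_of_image hS₁ hT₁ hS₂ hT₂ hd hun
  obtain ⟨hd₂, hu₂⟩ := hm.symm.partition_of_image hS₂ hT₂ hS₁ hT₁
    (by rwa [Set.union_comm, Set.union_comm (_ '' T₂)])
    (by rwa [Set.union_comm (_ '' S₂), Set.union_comm (_ '' T₂)])
  rw [hm.isMinConnecting_iff hS₁ hS₂] at hS
  rw [hm.isMinConnecting_iff hT₁ hT₂] at hT
  rcases hS with hS | hS <;> rcases hT with hT | hT
  · exact absurd hu₁ (h.not_isMinConnecting_and hG hv hvA hS.1 hT.1 hd₁)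
  · obtain ⟨p₁, p₂, hp₁, hp₂, -⟩ :=
      hm.exists_gluePair_eq_image hd₁ hu₁ hd₂ hu₂ hS.1 hT.1 hS.2 hT.2
    exact ⟨⟨p₁, hp₁⟩, ⟨p₂, hp₂⟩⟩
  · obtain ⟨p₁, p₂, hp₁, hp₂, -⟩ := hm.exists_gluePair_eq_image hd₁.symm
      ((Set.union_comm _ _).trans hu₁) hd₂.symm ((Set.union_comm _ _).trans hu₂)
      hT.1 hS.1 hT.2 hS.2
    exact ⟨⟨p₁, hp₁⟩, ⟨p₂, hp₂⟩⟩
  · exact absurd hu₂ (h.symm.not_isMinConnecting_and hG hu huB hS.2 hT.2 hd₂)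

/-- An edge `e` from `x` to `y` outside `F` could take the place of the seam edge. The part with
edges `insert e F` would then be bispanning in `G`, although it misses `v`. -/
theorem not_isLink_of_isBispanning (h : IsSeparation G A B F x y) (hG : G.IsAtomicBispanning)
    {v : α} (hv : v ∈ V(G)) (hvA : v ∉ A) (hb : (G.seamPart A F x y).IsBispanning)
    {e : β} (heF : e ∉ F) : ¬ G.IsLink e x y := by
  intro hl
  obtain ⟨⟨S, T⟩, hp⟩ := hb
  obtain ⟨hS, hT, hd, hu⟩ := isTreePair_iff.1 hp
  simp only at hS hT hd hu
  rw [h.edgeSet_seamPart] at hu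
  refine h.not_isBispanning_part hG hv hvA (insert e F)
    (hS.isBispanning_mapEdges (ρ := fun o => o.getD e) hT hd h.vertexSet_seamPart ?_ ?_ ?_)
  · rw [hu]
    rintro _ (rfl | ⟨f, hf, rfl⟩) a b hab
    · rcases hab with ⟨rfl, rfl⟩ | ⟨rfl, rfl⟩
      · exact ⟨⟨.inl rfl, hl⟩, h.left_mem.1, h.right_mem.1⟩
      · exact ⟨⟨.inl rfl, hl.symm⟩, h.right_mem.1, h.left_mem.1⟩
    · exact ⟨⟨.inr hf, hab.1.2⟩, hab.2⟩
  · rw [hu]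
    rintro _ (rfl | ⟨f, hf, rfl⟩) _ (rfl | ⟨g, hg, rfl⟩) hfg
    · rfl
    · exact absurd hg ((show e = g from hfg) ▸ heF)
    · exact absurd hf ((show f = e from hfg) ▸ heF)
    · exact congrArg some hfg
  · rw [hu, Set.image_insert_eq, Set.image_image]
    simp only [Option.getD_none, Option.getD_some, Set.image_id']
    ext g
    rw [edge_mem_iff_exists_isLink]
    constructor
    · rintro ⟨a, b, hab⟩
      exact hab.1.1
    · rintro (rfl | hg)
      · exact ⟨x, y, ⟨.inl rfl, hl⟩, h.left_mem.1, h.right_mem.1⟩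
      · obtain ⟨a, b, hab⟩ := exists_isLink_of_mem_edgeSet (h.subset_edgeSet hg)
        exact ⟨a, b, ⟨.inr hg, hab⟩, h.mem_left g hg a b hab, h.mem_left g hg b a hab.symm⟩

end IsSeparation

theorem IsTreePair.ne_of_isLink {p : Set β × Set β} (hp : G.IsTreePair p) {e : β} {a b : α}
    (hl : G.IsLink e a b) : a ≠ b := by
  rintro rfl
  obtain ⟨h₁, h₂, -, hu⟩ := isTreePair_iff.1 hp
  have he := hl.edge_mem
  rw [← hu] at he
  exact he.elim (fun he => h₁.not_reach he hl (.refl _ _ _))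
    (fun he => h₂.not_reach he hl (.refl _ _ _))

theorem isMinConnecting_singleton {e : β} {a b : α} (hl : G.IsLink e a b) (hab : a ≠ b)
    (hV : V(G) = {a, b}) : G.IsMinConnecting {e} := by
  have hr : G.Reach {e} a b := hl.reach rfl
  refine ⟨Set.singleton_subset_iff.2 hl.edge_mem, ⟨⟨a, hl.left_mem⟩, ?_⟩, ?_⟩
  · rw [hV]
    rintro _ (rfl | rfl) _ (rfl | rfl)
    exacts [.refl _ _ _, hr, hr.symm, .refl _ _ _]
  · rintro _ rfl hc
    obtain ⟨f, hf, -⟩ :=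
      (hc.2 a hl.left_mem b hl.right_mem).exists_crossing (· = a) rfl hab.symm
    exact hf.2 hf.1

/-- Two parallel edges and their ends form a bispanning subgraph on two vertices. -/
theorem IsAtomicBispanning.simple (hG : G.IsAtomicBispanning) (hV : 2 < V(G).encard) :
    G.Simple := by
  obtain ⟨p, hp⟩ := hG.1
  refine { not_isLoopAt := fun e a hl => hp.ne_of_isLink hl rfl, eq_of_isLink := ?_ }
  intro e f a b he hf
  by_contra hne
  have hab := hp.ne_of_isLink he
  have hA : {a, b} ⊆ V(G) := Set.insert_subset he.left_mem (Set.singleton_subset_iff.2 he.right_mem)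
  have he' : (G.part {a, b} {e, f}).IsLink e a b := ⟨⟨.inl rfl, he⟩, .inl rfl, .inr rfl⟩
  have hf' : (G.part {a, b} {e, f}).IsLink f a b := ⟨⟨.inr rfl, hf⟩, .inl rfl, .inr rfl⟩
  have hb : (G.part {a, b} {e, f}).IsBispanning := by
    refine ⟨({e}, {f}), isTreePair_iff.2 ⟨isMinConnecting_singleton he' hab rfl,
      isMinConnecting_singleton hf' hab rfl, Set.disjoint_singleton.2 hne, ?_⟩⟩
    refine Set.Subset.antisymm ?_ ?_
    · rintro g (rfl | rfl)
      exacts [he'.edge_mem, hf'.edge_mem]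
    · intro g hg
      obtain ⟨_, _, hl⟩ := exists_isLink_of_mem_edgeSet hg
      exact hl.1.1
  rcases hG.2 _ (part_le hA) hb with hK | ⟨w, hw⟩
  · have hVK : {a, b} = V(G) := congrArg vertexSet hK
    rw [← hVK, Set.encard_pair hab] at hV
    exact lt_irrefl _ hV
  · have hVK : {a, b} = {w} := congrArg vertexSet hw
    have ha : a ∈ ({w} : Set α) := hVK ▸ .inl rfl
    have hb : b ∈ ({w} : Set α) := hVK ▸ .inr rfl
    exact hab (ha.trans hb.symm)

theorem Connects.exists_isLink {U : Set β} (h : G.Connects U) {a b : α} (ha : a ∈ V(G))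
    (hb : b ∈ V(G)) (hab : a ≠ b) : ∃ e ∈ U, ∃ c ≠ a, G.IsLink e a c := by
  obtain ⟨f, hf, u, v, hl, rfl, hv⟩ := (h.2 a ha b hb).exists_crossing (· = a) rfl hab.symm
  exact ⟨f, hf, v, hv, hl⟩

/-- A simple bispanning graph does not have exactly three vertices. -/
theorem IsBispanning.encard_ne_three (hG : G.IsBispanning) (hs : G.Simple) :
    V(G).encard ≠ 3 := by
  intro h3
  obtain ⟨a, b, c, hab, hac, hbc, hV⟩ := Set.encard_eq_three.1 h3
  obtain ⟨p, hp⟩ := hG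
  obtain ⟨h₁, h₂, hd, -⟩ := isTreePair_iff.1 hp
  have ha : a ∈ V(G) := by simp [hV]
  have hb : b ∈ V(G) := by simp [hV]
  have hc : c ∈ V(G) := by simp [hV]
  have key : ∀ {U : Set β}, G.Connects U → ∀ {u v w : α}, V(G) = {u, v, w} → u ∈ V(G) →
      v ∈ V(G) → u ≠ v → (∃ e ∈ U, G.IsLink e u v) ∨ (∃ e ∈ U, G.IsLink e u w) := by
    intro U hU u v w hV hu hv huv
    obtain ⟨e, he, z, hz, hl⟩ := hU.exists_isLink hu hv huv
    have hzV := hl.right_mem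
    rw [hV] at hzV
    rcases hzV with rfl | rfl | rfl
    exacts [absurd rfl hz, .inl ⟨e, he, hl⟩, .inr ⟨e, he, hl⟩]
  have not_both : ∀ u v, ¬ ((∃ e ∈ p.1, G.IsLink e u v) ∧ (∃ e ∈ p.2, G.IsLink e u v)) := by
    rintro u v ⟨⟨e, he, hl⟩, ⟨f, hf, hl'⟩⟩
    exact Set.disjoint_left.1 hd he (hl.eq hl' ▸ hf)
  have comm : ∀ (U : Set β) u v, (∃ e ∈ U, G.IsLink e u v) ↔ (∃ e ∈ U, G.IsLink e v u) :=
    fun U u v => exists_congr fun e => and_congr_right fun _ => isLink_comm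
  have hVb : V(G) = {b, a, c} := by rw [hV, Set.insert_comm]
  have hVc : V(G) = {c, a, b} := by rw [hV]; ext; simp; tauto
  have s₁ := key h₁.connects hV ha hb hab
  have s₂ := key h₁.connects hVb hb ha hab.symm
  have s₃ := key h₁.connects hVc hc ha hac.symm
  have t₁ := key h₂.connects hV ha hb hab
  have t₂ := key h₂.connects hVb hb ha hab.symm
  have t₃ := key h₂.connects hVc hc ha hac.symm
  rw [comm _ b a] at s₂ t₂
  rw [comm _ c a, comm _ c b] at s₃ t₃
  -- Each tree meets every vertex, so it uses at least two of the three vertex pairs. Two trees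
  -- would need four, but by simplicity no pair serves both.
  have pigeonhole : ∀ {X Y Z X' Y' Z' : Prop}, X ∨ Y → X ∨ Z → Y ∨ Z → X' ∨ Y' → X' ∨ Z' →
      Y' ∨ Z' → ¬ (X ∧ X') → ¬ (Y ∧ Y') → ¬ (Z ∧ Z') → False := by
    intros
    grind
  exact pigeonhole s₁ s₂ s₃ t₁ t₂ t₃ (not_both a b) (not_both a c) (not_both b c)

theorem HasVertexConnectivity.exists_cut (hG : G.HasVertexConnectivity 2)
    (h3 : V(G).encard ≠ 3) : ∃ x ∈ V(G), ∃ y ∈ V(G), x ≠ y ∧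
      ∃ u ∈ V(G) \ {x, y}, ∃ v ∈ V(G) \ {x, y},
        ¬ (G.deleteVerts {x, y}).Reach E(G.deleteVerts {x, y}) u v := by
  obtain ⟨⟨hc, hcard, h2⟩, hmax⟩ := hG
  -- Having more than three vertices ensures that 3-connectivity fails because of a disconnecting
  -- set and not for lack of vertices.
  have h4 : (3 : ℕ∞) < V(G).encard := by
    refine lt_of_le_of_ne ?_ h3.symm
    have := Order.add_one_le_of_lt hcard
    norm_num at this
    exact this
  have hn : ¬ G.IsKVertexConnected 3 := fun h => by
    have : 3 ≤ 2 := hmax h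
    omega
  simp only [IsKVertexConnected, not_and, not_forall] at hn
  obtain ⟨X, hXV, hX3, hX⟩ := hn hc h4
  have hX2 : X.encard = 2 := by
    refine le_antisymm ?_ (not_lt.1 fun hlt => hX (h2 X hXV hlt))
    exact Order.le_of_lt_add_one (by simpa [show (2 : ℕ∞) + 1 = 3 by norm_num] using hX3)
  obtain ⟨x, y, hxy, rfl⟩ := Set.encard_eq_two.1 hX2
  refine ⟨x, hXV (.inl rfl), y, hXV (.inr rfl), hxy, ?_⟩
  rw [isConnected_iff_connects] at hX
  by_contra! hall
  refine hX ⟨?_, ?_⟩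
  · rw [vertexSet_deleteVerts, Set.nonempty_iff_ne_empty, Ne, Set.sdiff_eq_empty]
    intro hsub
    have := Set.encard_le_encard hsub
    rw [hX2] at this
    exact absurd (lt_of_lt_of_le h4 this) (by norm_num)
  · rw [vertexSet_deleteVerts]
    exact hall

/-- Take `P`, the component of `u` after deleting `x` and `y`, and let `F` be the edges that meet
`P`. Edges from `x` to `y` thereby all fall to the other side. -/
theorem exists_isSeparation {u v : α} (hx : x ∈ V(G)) (hy : y ∈ V(G)) (hxy : x ≠ y)
    (hu : u ∈ V(G) \ {x, y}) (hv : v ∈ V(G) \ {x, y})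
    (hr : ¬ (G.deleteVerts {x, y}).Reach E(G.deleteVerts {x, y}) u v) :
    ∃ A B F, IsSeparation G A B F x y ∧ u ∉ B ∧ v ∉ A ∧ ∀ e ∈ F, ¬ G.IsLink e x y := by
  set D := G.deleteVerts {x, y} with hD
  let P : Set α := {w | D.Reach E(D) u w}
  have hPV : ∀ w ∈ P, w ∈ V(G) \ {x, y} := by
    intro w hw
    have := Reach.right_mem (x := u) hw (by rw [hD, vertexSet_deleteVerts]; exact hu)
    rwa [hD, vertexSet_deleteVerts] at this
  have hxP : x ∉ P := fun h => (hPV x h).2 (.inl rfl)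
  have hyP : y ∉ P := fun h => (hPV y h).2 (.inr rfl)
  have hstep : ∀ e a b, G.IsLink e a b → a ∈ P → b ∈ P ∪ {x, y} := by
    intro e a b hl ha
    by_cases hb : b ∈ ({x, y} : Set α)
    · exact .inr hb
    · have hl' : D.IsLink e a b := by
        rw [hD, deleteVerts_isLink]
        exact ⟨hl, (hPV a ha).2, hb⟩
      exact .inl (Reach.trans (show D.Reach E(D) u a from ha) (hl'.reach hl'.edge_mem))
  have hX : {x, y} ⊆ V(G) := Set.insert_subset hx (Set.singleton_subset_iff.2 hy)
  refine ⟨P ∪ {x, y}, V(G) \ P, {e | ∃ a ∈ P, ∃ b, G.IsLink e a b}, ⟨hxy, ?_, ?_, ?_, ?_, ?_⟩,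
    fun h => h.2 (Reach.refl _ _ _), fun h => h.elim hr hv.2, ?_⟩
  · ext w
    constructor
    · rintro ((hw | hw) | hw)
      exacts [(hPV w hw).1, hX hw, hw.1]
    · intro hw
      by_cases hwP : w ∈ P
      exacts [.inl (.inl hwP), .inr ⟨hw, hwP⟩]
  · ext w
    constructor
    · rintro ⟨hw | hw, hw'⟩
      exacts [absurd hw hw'.2, hw]
    · intro hw
      refine ⟨.inr hw, hX hw, ?_⟩
      rcases hw with rfl | rfl
      exacts [hxP, hyP]
  · rintro e ⟨a, -, b, hl⟩
    exact hl.edge_mem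
  · rintro e ⟨a, ha, b, hl⟩ c d hl'
    obtain ⟨rfl, rfl⟩ | ⟨rfl, rfl⟩ := hl.eq_and_eq_or_eq_and_eq hl'
    exacts [.inl ha, hstep e _ _ hl ha]
  · intro e he a b hl
    exact ⟨hl.left_mem, fun ha => he ⟨a, ha, b, hl⟩⟩
  · rintro e ⟨a, ha, b, hl⟩ hl'
    rcases hl.left_eq_or_eq hl' with rfl | rfl
    exacts [hxP ha, hyP ha]

end Separation

end Graph

theorem mainTheorem2 {α β : Type*} (G : Graph α β) (hV : V(G).Finite) (hE : E(G).Finite)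
    (hG : G.IsAtomicBispanning) (hconn : G.HasVertexConnectivity 2) :
    (∃ (G₁ G₂ : Graph α (Option β)) (d₁ d₂ : Option β),
      G₁.Simple ∧ G₁.IsBispanning ∧ G₂.Simple ∧ G₂.IsBispanning ∧
        G.IsTwoCliqueSum G₁ G₂ d₁ d₂) ∧
    ∀ {α₁ α₂ β₁ β₂ : Type*} (G₁ : Graph α₁ β₁) (G₂ : Graph α₂ β₂) (d₁ : β₁) (d₂ : β₂),
      G₁.Simple → G₁.IsBispanning → G₂.Simple → G₂.IsBispanning →
      G.IsTwoCliqueSum G₁ G₂ d₁ d₂ →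
      Nonempty (G.tauThree.Iso (Graph.tauThreeJoin G₁ G₂ d₁ d₂)) := by
  have hcard : 2 < V(G).encard := hconn.1.2.1
  have hs : G.Simple := hG.simple hcard
  obtain ⟨x, hx, y, hy, hxy, u, hu, v, hv, hr⟩ :=
    hconn.exists_cut (hG.1.encard_ne_three hs)
  obtain ⟨e₀, he₀⟩ : E(G).Nonempty := by
    obtain ⟨e, he, -⟩ :=
      ((Graph.isConnected_iff_connects G).1 hconn.1.1).exists_isLink hx hy hxy
    exact ⟨e, he⟩
  constructor
  · obtain ⟨A, B, F, hsep, huB, hvA, hF⟩ := Graph.exists_isSeparation hx hy hxy hu hv hr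
    obtain ⟨h₁, h₂⟩ := hsep.isBispanning_seamParts hG hu.1 huB hv.1 hvA e₀
    -- By the choice of `F`, an edge from `x` to `y` would lie outside `F`, where it could replace
    -- the seam edge of the first part.
    have hno : ∀ e, ¬ G.IsLink e x y := fun e => by
      by_cases he : e ∈ F
      exacts [hF e he, hsep.not_isLink_of_isBispanning hG hv.1 hvA h₁ he]
    exact ⟨_, _, none, none, hsep.simple_seamPart hs hno, h₁, hsep.symm.simple_seamPart hs hno, h₂,
      (hsep.isAmalgam e₀).isTwoCliqueSum⟩
  · rintro α₁ α₂ β₁ β₂ G₁ G₂ d₁ d₂ hs₁ h₁ hs₂ h₂ ⟨x₁, y₁, x₂, y₂, hl₁, hl₂, ⟨i⟩⟩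
    obtain ⟨φ₁, φ₂, ψ₁, ψ₂, h⟩ :=
      i.exists_isAmalgam hl₁ hl₂ hl₁.ne hl₂.ne ⟨x, hx⟩ ⟨e₀, he₀⟩
    exact ⟨(h.joinIso hE h₁ h₂).symm⟩
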